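/- **Setting.** Let $0<\varepsilon<1$, let $d$ be a positive integer, let $k_0=\lceil\log_2(1/\varepsilon)\rceil+20$, and let $v_0=e_{d+1}\in\mathbb R^{d+1}$; identify $\mathbb R^d$ with the orthogonal complement of $v_0$. The Boolean domain is $\{-1,1\}$. 1-in-3-SAT is the predicate that exactly one of three entries is $1$, and NAE-SAT the predicate that the three entries are not all equal. Constraints may contain negated variables and the constants $\pm1$. For $y\in[-1,1]$ let $A'_y$ be the distribution of $y v_0+\sqrt{1-y^2}\,w$ with $w\sim\mathcal N(0,1/d)^d$. For $b\in\{-1,1\}$ and $x=1-2^{-k}$ with $k\ge1$, put $\rho_x=\frac{\sqrt{1-(2x-1)^2}}{2\sqrt{1-x^2}}$ and let $T'_{bx}$ be the distribution of the triple $$p_{1}=bxv_0+\sqrt{1-x^2}\bigl(-\rho_xw+\sqrt{1-\rho_x^2}\,u\bigr),\quad p_{2}=bxv_0+\sqrt{1-x^2}\bigl(-\rho_xw-\sqrt{1-\rho_x^2}\,u\bigr),\quad p_3=b(1-2x)v_0+\sqrt{1-(2x-1)^2}\,w,$$ where $u,w\sim\mathcal N(0,1/d)^d$ are independent. **Sampling.**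 A triple is sampled as follows. For each $k\in\{1,\dots,k_0\}$ and $b\in\{-1,1\}$, with probability $\frac1{2(k_0+1)}$ sample a triple from $T'_{b(1-2^{-k})}$. For each $b\in\{-1,1\}$, with probability $\frac1{2(k_0+1)}$ sample $p$ from $A'_{b(1-2^{-k_0})}$ and take the triple $(-bv_0,-bv_0,p)$. A sample is *discarded* if $|\|w\|^2-1|>\frac{\varepsilon}{1000}$, or if it is a sample from some $T'_{bx}$ and $|\|u\|^2-1|>\frac\varepsilon{1000}$ or $|w\cdot u|>\frac\varepsilon{1000}$. **Discretization.** Partition $\{v\in\mathbb R^{d+1}:\|v\|\le 2\}$ into finitely many measurable regions, and choose for each region a center within $\frac{\varepsilon}{1000}$ of all its points; the set $\{\|v\|>2\}$ is one further region with an arbitrary center. The variables of the instance are the centers, and $v_0$, $-v_0$ stand for the constants $1$, $-1$. Each sampled triple gives a constraint: every sampled vector other than $\pm v_0$ is replaced by the center of its region, and the constraint is imposed on the resulting triple for samples from $T'_{-x}$ and for $(-v_0,-v_0,p)$, and on the negation of the resulting triple for samples from $T'_{x}$ and for $(v_0,v_0,p)$ (here $x=1-2^{-k}>0$). The weight of a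 constraint is the probability that it is sampled (discarded or not). **Basic SDP.** A solution assigns unit vectors $v_0'$ and $v'_c$ (for each variable $c$) in some $\mathbb R^N$; a negated literal gets the opposite vector and the constant $\pm1$ gets $\pm v_0'$. It gives a constraint with literal vectors $v_1,v_2,v_3$ value at least $1-\varepsilon$ if there is a probability distribution $\mu$ on $\{-1,1\}^3$ with $\langle v_0',v_i\rangle=\mathbb E_\mu[a_i]$ and $\langle v_i,v_j\rangle=\mathbb E_\mu[a_ia_j]$ for all $i,j\in\{1,2,3\}$, and with $\mu(\text{1-in-3-SAT})\ge1-\varepsilon$. **Theorem.** Let $0<\varepsilon<1$ and $d\ge \frac{8\cdot10^7}{\varepsilon^3}$. Discretizations as above exist, and for every one of them: 1. There is a single solution of the basic SDP that gives value at least $1-\varepsilon$ to every constraint that comes from a sample that is not discarded. 2. The probability that a sample is discarded is at most $6e^{-10/\varepsilon}$. 3. For every assignment of values in $\{-1,1\}$ to the variables, the total weight of the NAE-SAT constraints that it violates (discarded samples included) is at least $\dfrac{1}{10^{60}\lceil\log_2(1/\varepsilon)\rceil}$. -/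

import Mathlib

namespace OneInThreeGap

noncomputable section

/-! ### Boolean PCSPs with negations and constants, and the basic SDP

The Boolean domain is `{-1, 1}`, realised as `ℤˣ`. -/

/-- A literal over the variables `V`: the literal `(s, some v)` is the variable `v` (if `s = 1`) or
its negation (if `s = -1`), and `(s, none)` is the constant `s`. -/
abbrev Literal (V : Type) : Type := ℤˣ × Option V

/-- The value of a literal under an assignment of the variables. -/
def Literal.eval {V : Type} (f : V → ℤˣ) (l : Literal V) : ℤˣ := l.1 * l.2.elim 1 f

/-- The real number `±1` given by a sign. -/
def signVal (s : ℤˣ) : ℝ := ((s : ℤ) : ℝ)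

/-- The vector of a literal: negated literals get the opposite vector, and the constant `1` gets the
truth vector `v₀`. -/
def Literal.vec {V : Type} {N : ℕ} (v₀ : EuclideanSpace ℝ (Fin N))
    (v : V → EuclideanSpace ℝ (Fin N)) (l : Literal V) : EuclideanSpace ℝ (Fin N) :=
  signVal l.1 • l.2.elim v₀ v

/-- A constraint is a triple of literals. -/
abbrev Clause (V : Type) : Type := Fin 3 → Literal V

/-- `1-in-3-SAT`: exactly one of the three entries is `1`. -/
def oneInThree : Set (Fin 3 → ℤˣ) := {a | ∃! i, a i = 1}

/-- `NAE-SAT`: the three entries are not all equal. -/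
def notAllEqual : Set (Fin 3 → ℤˣ) := {a | ∃ i j, a i ≠ a j}

/-- `μ` is a probability distribution on `{-1, 1}³` whose first and second moments are given by the
inner products of the vectors `v₀, v 0, v 1, v 2`. -/
structure IsLocalDistribution {N : ℕ} (v₀ : EuclideanSpace ℝ (Fin N))
    (v : Fin 3 → EuclideanSpace ℝ (Fin N)) (μ : (Fin 3 → ℤˣ) → ℝ) : Prop where
  nonneg : ∀ a, 0 ≤ μ a
  sum_eq_one : ∑ a, μ a = 1
  first_moment : ∀ i, inner ℝ v₀ (v i) = ∑ a, signVal (a i) * μ a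
  second_moment : ∀ i j, inner ℝ (v i) (v j) = ∑ a, signVal (a i) * signVal (a j) * μ a

/-- The vectors form a `1 - ε` approximate vector assignment to the predicate `P`. -/
def IsApproxVectorAssignment {N : ℕ} (P : Set (Fin 3 → ℤˣ)) (ε : ℝ)
    (v₀ : EuclideanSpace ℝ (Fin N)) (v : Fin 3 → EuclideanSpace ℝ (Fin N)) : Prop :=
  ∃ μ : (Fin 3 → ℤˣ) → ℝ, IsLocalDistribution v₀ v μ ∧ 1 - ε ≤ ∑ a, P.indicator μ a

/-! ### The sampled triples of vectors in `ℝ^(d+1)` -/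

/-- `k₀ = ⌈log₂ (1/ε)⌉ + 20`. -/
def k₀ (ε : ℝ) : ℕ := ⌈Real.logb 2 (1 / ε)⌉₊ + 20

/-- `1 - 2^{-k}`. -/
def level (k : ℕ) : ℝ := 1 - (1 / 2 : ℝ) ^ k

/-- The ambient space `ℝ^(d+1)`. -/
abbrev Space (d : ℕ) : Type := EuclideanSpace ℝ (Fin (d + 1))

/-- `e_{d+1}`, written `v₀`. -/
def e₀ (d : ℕ) : Space d := EuclideanSpace.single (Fin.last d) 1

/-- The inclusion `ℝ^d ⊆ ℝ^(d+1)` as the orthogonal complement of `e_{d+1}`. -/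
def perp {d : ℕ} (w : Fin d → ℝ) : Space d :=
  WithLp.toLp 2 (Fin.snoc (α := fun _ => ℝ) w 0)

/-- The distribution `𝒩(0, 1/d)^d`. -/
def gauss (d : ℕ) : MeasureTheory.Measure (Fin d → ℝ) :=
  MeasureTheory.Measure.pi fun _ => ProbabilityTheory.gaussianReal 0 (1 / (d : NNReal))

/-- `y v₀ + √(1 - y²) w`; for Gaussian `w` this is a sample of `A'_y`. -/
def pointA {d : ℕ} (y : ℝ) (w : Fin d → ℝ) : Space d :=
  y • e₀ d + √(1 - y ^ 2) • perp w

/-- The noise coefficient `ρ_x`. -/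
def rho (x : ℝ) : ℝ := √(1 - (2 * |x| - 1) ^ 2) / (2 * √(1 - x ^ 2))

/-- The triple `(p₁, p₂, p₃)`; for independent Gaussian `u, w` and `x ≥ 0` this is a sample of `T'_x`
if `b = 1` and of `T'_{-x}` if `b = -1`. -/
def tripleT {d : ℕ} (x : ℝ) (b : ℤˣ) (u w : Fin d → ℝ) : Fin 3 → Space d :=
  ![(signVal b * x) • e₀ d + √(1 - x ^ 2) • (-rho x • perp w + √(1 - rho x ^ 2) • perp u),
    (signVal b * x) • e₀ d + √(1 - x ^ 2) • (-rho x • perp w - √(1 - rho x ^ 2) • perp u),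
    (signVal b * (1 - 2 * x)) • e₀ d + √(1 - (2 * |x| - 1) ^ 2) • perp w]

/-- The `2 (k₀ + 1)` equally likely kinds of samples. The kind `(some j, b)` is a triple of `T'_{b x}`
with `x = 1 - 2^{-k}` and `k = j + 1`; the kind `(none, b)` is a triple `(-b v₀, -b v₀, p)` with
`p` from `A'_{b x₀}` and `x₀ = 1 - 2^{-k₀}`. -/
abbrev Kind (ε : ℝ) : Type := Option (Fin (k₀ ε)) × ℤˣ

/-- The probability of an event when a sample is drawn: each kind has probability `1 / (2 (k₀ + 1))`,
and `u, w` are independent Gaussian vectors (`u` is not used for the kinds `(none, b)`). -/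
def sampleProb (ε : ℝ) (d : ℕ) (A : Kind ε → (Fin d → ℝ) → (Fin d → ℝ) → Prop) : ℝ :=
  ∑ κ : Kind ε, 1 / (2 * ((k₀ ε : ℝ) + 1)) *
    ((gauss d).prod (gauss d)).real {p | A κ p.1 p.2}

/-- The samples that are discarded. -/
def Discarded (ε : ℝ) {d : ℕ} (κ : Kind ε) (u w : Fin d → ℝ) : Prop :=
  ε / 1000 < |w ⬝ᵥ w - 1| ∨
    (κ.1 ≠ none ∧ (ε / 1000 < |u ⬝ᵥ u - 1| ∨ ε / 1000 < |w ⬝ᵥ u|))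

/-! ### The discretized instance -/

/-- A discretization of `ℝ^(d+1)`: the vectors of length at most `2` are partitioned into `m`
(measurable) regions, each with a center that is within `ε / 1000` of all points of the region. The
vectors of length greater than `2` form one further region `none`, with an arbitrary center. -/
structure Discretization (ε : ℝ) (d : ℕ) where
  m : ℕ
  region : Space d → Option (Fin m)
  measurableSet_region : ∀ r, MeasurableSet (region ⁻¹' {r})
  region_eq_none_iff : ∀ v, region v = none ↔ 2 < ‖v‖
  center : Option (Fin m) → Space d
  dist_center_le : ∀ v, ‖v‖ ≤ 2 → dist v (center (region v)) ≤ ε / 1000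

namespace Discretization

variable {ε : ℝ} {d : ℕ} (D : Discretization ε d)

/-- The variables of the instance are the centers. -/
abbrev Var : Type := Set.range D.center

instance : Fintype D.Var := Fintype.ofFinite _

/-- The center that replaces a vector. -/
def round (v : Space d) : D.Var := ⟨D.center (D.region v), Set.mem_range_self _⟩

/-- The constraint of a sample. The vectors of a triple of `T'_{b x}` sum to `b v₀`, so the constraint
is put on the (discretized) vectors if `b = -1` and on their negations if `b = 1`. Likewise the
constraint is put on `(-v₀, -v₀, p)` for `p` from `A'_{x₀}` and on the negations of `(v₀, v₀, p)` for
`p` from `A'_{-x₀}`. The vector `v₀` is the constant `1`. -/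
def clause : Kind ε → (Fin d → ℝ) → (Fin d → ℝ) → Clause D.Var
  | (some j, b), u, w => fun i => (-b, some (D.round (tripleT (level (j + 1)) b u w i)))
  | (none, b), _, w =>
      ![(-1, none), (-1, none), (b, some (D.round (pointA (signVal b * level (k₀ ε)) w)))]

/-- The weight of a constraint: the probability that it is sampled (discarded or not). -/
def weight (C : Clause D.Var) : ℝ := sampleProb ε d fun κ u w => D.clause κ u w = C

/-- The constraints that come from a sample that is not discarded. -/
def Retained (C : Clause D.Var) : Prop := ∃ κ u w, ¬ Discarded ε κ u w ∧ D.clause κ u w = C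

/-- The total weight of the sampled `NAE-SAT` constraints that are violated by an assignment. -/
def violatedWeight (f : D.Var → ℤˣ) : ℝ :=
  ∑ C : Clause D.Var, {C | (fun i => (C i).eval f) ∉ notAllEqual}.indicator D.weight C

end Discretization

end

end OneInThreeGap

namespace OneInThreeGap

open MeasureTheory ProbabilityTheory
open scoped ENNReal

/-! ### Rotation invariance of the Gaussian measure -/

/-! Soundness. After rounding, an assignment is just a measurable `±1` function on the levels `±(1 -
2^{-k})`, so rounding costs nothing here. Let `q b k` be the Gaussian measure of the points of level
`b (1 - 2^{-k})` with value `-b`. The constraints with two constants bound `q b k₀`. In a triple of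
`T'_{bx}` with `x` of level `k + 1`, the third point lies on level `k` with sign `-b`. If it is in
the minority there, the constraint is violated unless one of the first two points is in the minority
on level `k + 1`. Given `w`, those two points are noisy copies of `-w` with correlation `rho x ≤
1/√2`, for which hypercontractivity from `L²` to `L³` holds. Hence `q (-b) k ≤ 64 (q b (k+1))^{3/2}
+ 2δ`, where `δ` is the violation probability (`measure_minority_step`). While `q` is small the
power `3/2` absorbs the factor 64, so going down from `k₀` to 0 the minorities grow only by the
violations. But level 0 is the same for both signs, so `q 1 0 + q (-1) 0 = 1`; the violations
therefore add up to a constant (`sum_violated_ge`).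

The hypercontractive inequality is elementary for these exponents. The cube of the noise operator
integrates `g` over three Gaussians with pairwise correlation `1/2`. These can be written
`(a+b)/√2`, `(a+c)/√2`, `(b+c)/√2`, and Cauchy-Schwarz applied twice finishes
(`lintegral_triangle_le`).

Completeness. If `u, w` were orthonormal, the triple with its signs would have exactly the moments
of the distribution with masses `(1-x)/2, (1-x)/2, x` on the three satisfying strings. Giving each
variable and `v₀` a private orthogonal noise direction scales the moments by `1 - η`, which mixes in
`η` times the uniform distribution; this slack absorbs the errors of rounding and of
non-orthonormality (`isApproxVectorAssignment_of_near`). Two literals with the same center get no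
independent noise and are treated separately.

Discarding is rare by Chernoff bounds for `‖w‖²` and `w · u`. -/

instance isProbabilityMeasure_gauss (d : ℕ) : IsProbabilityMeasure (gauss d) := by
  unfold gauss; infer_instance

instance isGaussian_gauss (d : ℕ) : IsGaussian (gauss d) := by
  have hind : iIndepFun (fun (i : Fin d) (w : Fin d → ℝ) => w i) (gauss d) := by
    unfold gauss
    exact iIndepFun_pi (X := fun _ => id) fun _ => aemeasurable_id
  have hlaw : ∀ i : Fin d, HasGaussianLaw (fun w : Fin d → ℝ => w i) (gauss d) := fun i => by
    refine ⟨?_⟩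
    have : (gauss d).map (fun w : Fin d → ℝ => w i) = gaussianReal 0 (1 / (d : NNReal)) :=
      (measurePreserving_eval (fun _ : Fin d => gaussianReal 0 (1 / (d : NNReal))) i).map_eq
    rw [this]; infer_instance
  have h := (hind.hasGaussianLaw hlaw).isGaussian_map
  have e : (fun w : Fin d → ℝ => fun i => w i) = id := rfl
  rwa [e, Measure.map_id] at h

lemma map_eval_gauss (d : ℕ) (i : Fin d) :
    (gauss d).map (fun w : Fin d → ℝ => w i) = gaussianReal 0 (1 / (d : NNReal)) :=
  (measurePreserving_eval (fun _ : Fin d => gaussianReal 0 (1 / (d : NNReal))) i).map_eq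

lemma integral_id_gauss (d : ℕ) : (gauss d)[id] = 0 := by
  ext i
  have hint : Integrable id (gauss d) := (IsGaussian.memLp_id (gauss d) 1 (by simp)).integrable le_rfl
  have := (ContinuousLinearMap.proj (R := ℝ) (φ := fun _ : Fin d => ℝ) i).integral_comp_comm hint
  simp only [ContinuousLinearMap.proj_apply, id] at this
  rw [Pi.zero_apply]
  refine this.symm.trans ?_
  have h2 : ∫ w, w i ∂(gauss d) = ∫ t, t ∂((gauss d).map (fun w : Fin d → ℝ => w i)) :=
    (integral_map (φ := fun w : Fin d → ℝ => w i) (f := fun t : ℝ => t)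
      (measurable_pi_apply i).aemeasurable aestronglyMeasurable_id).symm
  rw [h2, map_eval_gauss, integral_id_gaussianReal]

/-- The angle is `arccos c`, whose sine is nonnegative; hence the condition on `s`. -/
lemma lintegral_rotation {d : ℕ} {F : (Fin d → ℝ) → (Fin d → ℝ) → ℝ≥0∞}
    (hF : Measurable F.uncurry) {c s : ℝ} (hs : 0 ≤ s) (hcs : c ^ 2 + s ^ 2 = 1) :
    ∫⁻ x, ∫⁻ y, F x y ∂gauss d ∂gauss d
      = ∫⁻ x, ∫⁻ y, F (c • x + s • y) (-s • x + c • y) ∂gauss d ∂gauss d := by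
  have hc : Real.cos (Real.arccos c) = c := Real.cos_arccos (by nlinarith) (by nlinarith)
  have hs' : Real.sin (Real.arccos c) = s := by
    rw [Real.sin_arccos, ← Real.sqrt_sq hs]; congr 1; linarith
  have hrot := IsGaussian.map_rotation_eq_self (integral_id_gauss d) (Real.arccos c)
  have h1 := lintegral_prod (μ := gauss d) (ν := gauss d) F.uncurry hF.aemeasurable
  have hmeas : Measurable (ContinuousLinearMap.rotation (E := Fin d → ℝ) (Real.arccos c)) :=
    by fun_prop
  rw [← hrot, lintegral_map hF hmeas, lintegral_prod _ (by fun_prop)] at h1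
  simpa [Function.uncurry, ContinuousLinearMap.rotation_apply, hc, hs'] using h1.symm

lemma lintegral_lintegral_symm {d : ℕ} {F : (Fin d → ℝ) → (Fin d → ℝ) → ℝ≥0∞}
    (hF : Measurable F.uncurry) :
    ∫⁻ x, ∫⁻ y, F x y ∂gauss d ∂gauss d = ∫⁻ x, ∫⁻ y, F y x ∂gauss d ∂gauss d :=
  lintegral_lintegral_swap hF.aemeasurable

/-- Invariance under a rotation by `π / 4` followed by a reflection. -/
lemma lintegral_hadamard {d : ℕ} {F : (Fin d → ℝ) → (Fin d → ℝ) → ℝ≥0∞}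
    (hF : Measurable F.uncurry) {r : ℝ} (hr : 0 ≤ r) (hr2 : r ^ 2 = 1 / 2) :
    ∫⁻ x, ∫⁻ y, F x y ∂gauss d ∂gauss d
      = ∫⁻ x, ∫⁻ y, F (r • (x + y)) (r • (x - y)) ∂gauss d ∂gauss d := by
  rw [lintegral_rotation hF hr (by linarith : r ^ 2 + r ^ 2 = 1), lintegral_lintegral_symm]
  · refine lintegral_congr fun x => lintegral_congr fun y => ?_
    congr 1
    · module
    · module
  · change Measurable (fun p : (Fin d → ℝ) × (Fin d → ℝ) =>
      F.uncurry (r • p.1 + r • p.2, -r • p.1 + r • p.2))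
    fun_prop

lemma lintegral_comp_rotation {d : ℕ} {f : (Fin d → ℝ) → ℝ≥0∞} (hf : Measurable f) {c s : ℝ}
    (hs : 0 ≤ s) (hcs : c ^ 2 + s ^ 2 = 1) :
    ∫⁻ x, ∫⁻ y, f (c • x + s • y) ∂gauss d ∂gauss d = ∫⁻ x, f x ∂gauss d := by
  rw [← lintegral_rotation (F := fun x _ => f x) (by change Measurable fun p : _ × _ => f p.1; fun_prop) hs hcs]
  simp

lemma lintegral_comp_neg {d : ℕ} {f : (Fin d → ℝ) → ℝ≥0∞} (hf : Measurable f) :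
    ∫⁻ x, f (-x) ∂gauss d = ∫⁻ x, f x ∂gauss d := by
  rw [← lintegral_comp_rotation hf (c := -1) (s := 0) le_rfl (by norm_num)]
  simp

/-! ### The hypercontractive inequality -/

lemma lintegral_mul_le_sqrt {α : Type*} [MeasurableSpace α] (μ : Measure α) {f g : α → ℝ≥0∞}
    (hf : AEMeasurable f μ) (hg : AEMeasurable g μ) :
    ∫⁻ x, f x * g x ∂μ ≤ (∫⁻ x, f x ^ 2 ∂μ) ^ (1 / 2 : ℝ) * (∫⁻ x, g x ^ 2 ∂μ) ^ (1 / 2 : ℝ) := by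
  have h := ENNReal.lintegral_mul_le_Lp_mul_Lq μ (p := 2) (q := 2) (by constructor <;> norm_num) hf hg
  simpa [ENNReal.rpow_ofNat] using h

lemma rpow_half_sq (x : ℝ≥0∞) : (x ^ (1 / 2 : ℝ)) ^ 2 = x := by
  rw [← ENNReal.rpow_natCast, ← ENNReal.rpow_mul]; norm_num

/-- A Loomis-Whitney type inequality. -/
lemma lintegral_triangle_le {α : Type*} [MeasurableSpace α] (μ : Measure α) [SFinite μ]
    {G : α → α → ℝ≥0∞} (hG : Measurable G.uncurry) :
    ∫⁻ a, ∫⁻ b, ∫⁻ c, G a b * (G a c * G b c) ∂μ ∂μ ∂μ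
      ≤ (∫⁻ a, ∫⁻ b, G a b ^ 2 ∂μ ∂μ) ^ (3 / 2 : ℝ) := by
  set S := ∫⁻ a, ∫⁻ b, G a b ^ 2 ∂μ ∂μ with hS
  set L : α → ℝ≥0∞ := fun a => (∫⁻ c, G a c ^ 2 ∂μ) ^ (1 / 2 : ℝ) with hL
  have hGa : ∀ a, Measurable (G a) := fun a => hG.comp measurable_prodMk_left
  have hG2 : Measurable (fun p : α × α => G p.1 p.2 ^ 2) := hG.pow_const 2
  have hLm : Measurable L := (hG2.lintegral_prod_right').pow_const _
  have hLS : ∫⁻ a, L a ^ 2 ∂μ = S := by simp only [hL, rpow_half_sq, hS]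
  have hLm' : Measurable (fun p : α × α => L p.1 * L p.2) := by fun_prop
  calc ∫⁻ a, ∫⁻ b, ∫⁻ c, G a b * (G a c * G b c) ∂μ ∂μ ∂μ
      ≤ ∫⁻ a, ∫⁻ b, G a b * (L a * L b) ∂μ ∂μ := by
        -- Cauchy-Schwarz in `c` with `a, b` fixed; the second use, in `(a, b)`, separates `G a b`
        -- from `L a * L b`.
        refine lintegral_mono fun a => lintegral_mono fun b => ?_
        refine (lintegral_const_mul (G a b) ((hGa a).mul (hGa b))).trans_le ?_
        gcongr
        exact lintegral_mul_le_sqrt μ (hGa a).aemeasurable (hGa b).aemeasurable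
    _ = ∫⁻ p, G p.1 p.2 * (L p.1 * L p.2) ∂(μ.prod μ) :=
        (lintegral_prod (fun p : α × α => G p.1 p.2 * (L p.1 * L p.2))
          (hG.mul hLm').aemeasurable).symm
    _ ≤ (∫⁻ p, G p.1 p.2 ^ 2 ∂(μ.prod μ)) ^ (1 / 2 : ℝ)
          * (∫⁻ p, (L p.1 * L p.2) ^ 2 ∂(μ.prod μ)) ^ (1 / 2 : ℝ) :=
        lintegral_mul_le_sqrt _ (Measurable.aemeasurable hG) hLm'.aemeasurable
    _ = S ^ (1 / 2 : ℝ) * (S * S) ^ (1 / 2 : ℝ) := by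
        rw [lintegral_prod _ hG2.aemeasurable]
        simp_rw [mul_pow]
        rw [lintegral_prod_mul (hLm.pow_const 2).aemeasurable (hLm.pow_const 2).aemeasurable, hLS]
    _ = S ^ (3 / 2 : ℝ) := by
        rw [← ENNReal.mul_rpow_of_nonneg _ _ (by norm_num), ← pow_two, ← pow_succ',
          ← ENNReal.rpow_natCast, ← ENNReal.rpow_mul]
        norm_num

/-- The noise operator with correlation `1 / √2` is hypercontractive from `L²` to `L³`. -/
lemma lintegral_noise_cube_le {d : ℕ} {g : (Fin d → ℝ) → ℝ≥0∞} (hg : Measurable g) {r : ℝ}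
    (hr : 0 ≤ r) (hr2 : r ^ 2 = 1 / 2) :
    ∫⁻ w, (∫⁻ u, g (r • (w + u)) ∂gauss d) ^ 3 ∂gauss d
      ≤ (∫⁻ x, g x ^ 2 ∂gauss d) ^ (3 / 2 : ℝ) := by
  have hG : Measurable (Function.uncurry fun a b : Fin d → ℝ => g (r • (a + b))) := by
    unfold Function.uncurry; fun_prop
  have key := lintegral_triangle_le (gauss d) hG
  have hrot : ∫⁻ a, ∫⁻ b, g (r • (a + b)) ^ 2 ∂gauss d ∂gauss d = ∫⁻ x, g x ^ 2 ∂gauss d := by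
    rw [← lintegral_comp_rotation (hg.pow_const 2) hr (by linarith : r ^ 2 + r ^ 2 = 1)]
    simp only [smul_add]
  rw [hrot] at key
  -- It remains to see that `r(w+u₁), r(w+u₂), r(w+u₃)` and `r(a+b), r(a+c), r(b+c)` have the same
  -- joint law. Rotations of pairs show it; on the way `q` and `m` enter only through `q + m`, which
  -- removes one of the four variables.
  refine le_trans (le_of_eq ?_) key
  have hrr : r * r = 1 / 2 := by rw [← pow_two, hr2]
  have hcube : ∀ w : Fin d → ℝ, (∫⁻ u, g (r • (w + u)) ∂gauss d) ^ 3
      = ∫⁻ u₁, ∫⁻ u₂, ∫⁻ u₃, g (r • (w + u₁)) * (g (r • (w + u₂)) * g (r • (w + u₃))) ∂gauss d ∂gauss d ∂gauss d := by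
    intro w
    have hm : Measurable fun u => g (r • (w + u)) := by fun_prop
    have h3 : ∀ a b : ℝ≥0∞, ∫⁻ u, a * (b * g (r • (w + u))) ∂gauss d
        = a * (b * ∫⁻ u, g (r • (w + u)) ∂gauss d) := fun a b => by
      rw [lintegral_const_mul _ (hm.const_mul b), lintegral_const_mul _ hm]
    have h2 : ∀ a b : ℝ≥0∞, ∫⁻ u, a * (g (r • (w + u)) * b) ∂gauss d
        = a * ((∫⁻ u, g (r • (w + u)) ∂gauss d) * b) := fun a b => by
      rw [lintegral_const_mul _ (hm.mul_const b), lintegral_mul_const _ hm]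
    simp_rw [h3, h2]
    rw [lintegral_mul_const _ hm]
    ring
  simp_rw [hcube]
  have m1 : Measurable fun z : (((Fin d → ℝ) × (Fin d → ℝ)) × (Fin d → ℝ)) × (Fin d → ℝ) =>
      g (r • (z.1.1.1 + z.1.1.2)) *
        (g (r • (z.1.1.1 + z.1.2)) * g (r • (z.1.1.1 + z.2))) := by fun_prop
  -- the pair `(w, u₁)`
  rw [lintegral_hadamard (F := fun w u₁ => ∫⁻ u₂, ∫⁻ u₃, g (r • (w + u₁)) *
    (g (r • (w + u₂)) * g (r • (w + u₃))) ∂gauss d ∂gauss d) m1.lintegral_prod_right'.lintegral_prod_right' hr hr2]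
  -- the pair `(u₂, u₃)`
  have e1 : ∀ p q : Fin d → ℝ, ∫⁻ u₂, ∫⁻ u₃, g (r • (r • (p + q) + r • (p - q))) *
      (g (r • (r • (p + q) + u₂)) * g (r • (r • (p + q) + u₃))) ∂gauss d ∂gauss d
      = ∫⁻ m, ∫⁻ n, g p * (g ((1 / 2 : ℝ) • p + ((1 / 2 : ℝ) • (q + m)) + (1 / 2 : ℝ) • n) *
        g ((1 / 2 : ℝ) • p + ((1 / 2 : ℝ) • (q + m)) - (1 / 2 : ℝ) • n)) ∂gauss d ∂gauss d := by
    intro p q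
    rw [lintegral_hadamard (F := fun u₂ u₃ => g (r • (r • (p + q) + r • (p - q))) *
      (g (r • (r • (p + q) + u₂)) * g (r • (r • (p + q) + u₃)))) (by unfold Function.uncurry; fun_prop) hr hr2]
    refine lintegral_congr fun m => lintegral_congr fun n => ?_
    simp only [smul_add, smul_sub, smul_smul, hrr]
    congr 2
    · module
    · congr 1; module
    · congr 1; module
  simp_rw [e1]
  -- the pair `(q, m)`
  have e2 : ∀ p : Fin d → ℝ, ∫⁻ q, ∫⁻ m, ∫⁻ n,
        g p * (g ((1 / 2 : ℝ) • p + ((1 / 2 : ℝ) • (q + m)) + (1 / 2 : ℝ) • n) *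
        g ((1 / 2 : ℝ) • p + ((1 / 2 : ℝ) • (q + m)) - (1 / 2 : ℝ) • n)) ∂gauss d ∂gauss d ∂gauss d
      = ∫⁻ t, ∫⁻ n, g p * (g ((1 / 2 : ℝ) • p + r • t + (1 / 2 : ℝ) • n) *
        g ((1 / 2 : ℝ) • p + r • t - (1 / 2 : ℝ) • n)) ∂gauss d ∂gauss d := by
    intro p
    have m2 : Measurable fun z : (Fin d → ℝ) × (Fin d → ℝ) =>
        g p * (g ((1 / 2 : ℝ) • p + r • z.1 + (1 / 2 : ℝ) • z.2) *
          g ((1 / 2 : ℝ) • p + r • z.1 - (1 / 2 : ℝ) • z.2)) := by fun_prop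
    rw [← lintegral_comp_rotation (f := fun t => ∫⁻ n, g p * (g ((1 / 2 : ℝ) • p + r • t + (1 / 2 : ℝ) • n) *
        g ((1 / 2 : ℝ) • p + r • t - (1 / 2 : ℝ) • n)) ∂gauss d) m2.lintegral_prod_right'
      hr (by linarith : r ^ 2 + r ^ 2 = 1)]
    simp only [smul_add, smul_smul, hrr]
  simp_rw [e2]
  -- the pair `(p, n)`
  have e3 : ∫⁻ p, ∫⁻ t, ∫⁻ n, g p * (g ((1 / 2 : ℝ) • p + r • t + (1 / 2 : ℝ) • n) *
        g ((1 / 2 : ℝ) • p + r • t - (1 / 2 : ℝ) • n)) ∂gauss d ∂gauss d ∂gauss d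
      = ∫⁻ p, ∫⁻ n, ∫⁻ t, g p * (g ((1 / 2 : ℝ) • p + r • t + (1 / 2 : ℝ) • n) *
        g ((1 / 2 : ℝ) • p + r • t - (1 / 2 : ℝ) • n)) ∂gauss d ∂gauss d ∂gauss d := by
    refine lintegral_congr fun p => ?_
    exact lintegral_lintegral_swap (by unfold Function.uncurry; fun_prop)
  have m3 : Measurable fun z : ((Fin d → ℝ) × (Fin d → ℝ)) × (Fin d → ℝ) =>
      g z.1.1 * (g ((1 / 2 : ℝ) • z.1.1 + r • z.2 + (1 / 2 : ℝ) • z.1.2) *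
        g ((1 / 2 : ℝ) • z.1.1 + r • z.2 - (1 / 2 : ℝ) • z.1.2)) := by fun_prop
  rw [e3, lintegral_hadamard (F := fun p n => ∫⁻ t, g p *
    (g ((1 / 2 : ℝ) • p + r • t + (1 / 2 : ℝ) • n) *
        g ((1 / 2 : ℝ) • p + r • t - (1 / 2 : ℝ) • n)) ∂gauss d) m3.lintegral_prod_right'
    hr hr2]
  refine lintegral_congr fun a => lintegral_congr fun b => lintegral_congr fun c => ?_
  congr 2
  · congr 1; module
  · congr 1; module

/-- The noise operator with correlation at most `1 / √2` is hypercontractive from `L²` to `L³`. -/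
lemma gauss_noise_cube_le {d : ℕ} {A : Set (Fin d → ℝ)} (hA : MeasurableSet A) {ρ σ : ℝ}
    (hρ : 0 ≤ ρ) (hσ : 0 ≤ σ) (hρ2 : ρ ^ 2 ≤ 1 / 2) (hρσ : ρ ^ 2 + σ ^ 2 = 1) :
    ∫⁻ w, (gauss d {u | -ρ • w + σ • u ∈ A}) ^ 3 ∂gauss d ≤ (gauss d A) ^ (3 / 2 : ℝ) := by
  set f : (Fin d → ℝ) → ℝ≥0∞ := A.indicator 1 with hf
  have hfm : Measurable f := measurable_one.indicator hA
  -- Semigroup property: correlation `ρ` is correlation `τ` followed by correlation `1/√2`. So `g`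
  -- below is the indicator after noise `τ`, and `σ • u` is split into independent parts of sizes
  -- `ρ` and `κ`.
  set τ := √2 * ρ with hτ
  set κ := √(1 - τ ^ 2) with hκ
  set r := √(1 / 2 : ℝ) with hr
  have hr0 : 0 ≤ r := Real.sqrt_nonneg _
  have hr2 : r ^ 2 = 1 / 2 := Real.sq_sqrt (by norm_num)
  have hτ2 : τ ^ 2 = 2 * ρ ^ 2 := by rw [hτ, mul_pow, Real.sq_sqrt (by norm_num)]
  have hκ0 : 0 ≤ κ := Real.sqrt_nonneg _
  have hκ2 : κ ^ 2 = 1 - 2 * ρ ^ 2 := by rw [hκ, Real.sq_sqrt (by linarith), hτ2]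
  have hτr : τ * r = ρ := by
    have h0 : 0 ≤ τ * r := by positivity
    have : (τ * r) ^ 2 = ρ ^ 2 := by rw [mul_pow, hτ2, hr2]; ring
    exact (sq_eq_sq₀ h0 hρ).1 this
  have hσ0 : 0 < σ := by
    rcases hσ.lt_or_eq with h | h
    · exact h
    · subst h; linarith
  set g : (Fin d → ℝ) → ℝ≥0∞ := fun y => ∫⁻ v, f (τ • y + κ • v) ∂gauss d with hg
  have m1 : Measurable fun z : (Fin d → ℝ) × (Fin d → ℝ) => f (τ • z.1 + κ • z.2) := by fun_prop
  have hgm : Measurable g := m1.lintegral_prod_right'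
  have hq : ∀ w, gauss d {u | -ρ • w + σ • u ∈ A} = ∫⁻ u, g (r • (-w + u)) ∂gauss d := by
    intro w
    have m0 : Measurable fun u : Fin d → ℝ => -ρ • w + σ • u := by fun_prop
    have m2 : Measurable fun y : Fin d → ℝ => f (-ρ • w + σ • y) := hfm.comp m0
    calc gauss d {u | -ρ • w + σ • u ∈ A} = ∫⁻ y, f (-ρ • w + σ • y) ∂gauss d := by
          exact (lintegral_indicator_one (m0 hA)).symm
      _ = ∫⁻ u, ∫⁻ v, f (-ρ • w + σ • ((ρ / σ) • u + (κ / σ) • v)) ∂gauss d ∂gauss d := by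
          refine (lintegral_comp_rotation m2 (by positivity) ?_).symm
          rw [div_pow, div_pow, ← add_div, hκ2, div_eq_one_iff_eq (by positivity)]
          linarith
      _ = _ := by
          refine lintegral_congr fun u => lintegral_congr fun v => ?_
          congr 1
          rw [smul_add, smul_smul, smul_smul, smul_smul, hτr, mul_div_cancel₀ _ hσ0.ne',
            mul_div_cancel₀ _ hσ0.ne']
          module
  have hg2 : ∫⁻ x, g x ^ 2 ∂gauss d ≤ gauss d A := by
    -- Since `0 ≤ g ≤ 1`, the square may be dropped, and noise preserves the mean.
    calc ∫⁻ x, g x ^ 2 ∂gauss d ≤ ∫⁻ x, g x ∂gauss d := by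
          refine lintegral_mono fun x => ?_
          have h1 : g x ≤ 1 := by
            calc g x ≤ ∫⁻ v, 1 ∂gauss d := by
                  refine lintegral_mono fun v => ?_
                  exact Set.indicator_le_self' (by simp) _
              _ = 1 := by simp
          rw [pow_two]
          exact mul_le_of_le_one_left' h1
      _ = ∫⁻ x, f x ∂gauss d := lintegral_comp_rotation hfm hκ0 (by rw [hτ2, hκ2]; ring)
      _ = gauss d A := lintegral_indicator_one hA
  have m3 : Measurable fun w => (∫⁻ u, g (r • (w + u)) ∂gauss d) ^ 3 := by
    have : Measurable fun z : (Fin d → ℝ) × (Fin d → ℝ) => g (r • (z.1 + z.2)) := by fun_prop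
    exact this.lintegral_prod_right'.pow_const 3
  simp_rw [hq]
  rw [lintegral_comp_neg m3]
  exact (lintegral_noise_cube_le hgm hr0 hr2).trans (ENNReal.rpow_le_rpow hg2 (by norm_num))

/-! ### The sampled points -/

lemma perp_add {d : ℕ} (u w : Fin d → ℝ) : perp (u + w) = perp u + perp w := by
  ext i
  refine Fin.lastCases ?_ (fun j => ?_) i <;> simp [perp]

lemma perp_smul {d : ℕ} (c : ℝ) (w : Fin d → ℝ) : perp (c • w) = c • perp w := by
  ext i
  refine Fin.lastCases ?_ (fun j => ?_) i <;> simp [perp]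

lemma signVal_sq (b : ℤˣ) : signVal b ^ 2 = 1 := by
  rcases Int.units_eq_one_or b with rfl | rfl <;> simp [signVal]

lemma signVal_neg (b : ℤˣ) : signVal (-b) = -signVal b := by
  simp [signVal]

lemma rho_sq {x : ℝ} (h0 : 0 ≤ x) (h1 : x < 1) : rho x ^ 2 = x / (1 + x) := by
  have h2 : 0 < 1 - x ^ 2 := by nlinarith
  have h3 : 0 ≤ 1 - (2 * x - 1) ^ 2 := by nlinarith
  rw [rho, abs_of_nonneg h0, div_pow, mul_pow, Real.sq_sqrt h3, Real.sq_sqrt h2.le,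
    div_eq_div_iff (by positivity) (by positivity)]
  ring

lemma rho_nonneg (x : ℝ) : 0 ≤ rho x := by unfold rho; positivity

lemma rho_sq_le {x : ℝ} (h0 : 0 ≤ x) (h1 : x < 1) : rho x ^ 2 ≤ 1 / 2 := by
  rw [rho_sq h0 h1, div_le_div_iff₀ (by positivity) (by norm_num)]; linarith

lemma level_nonneg (k : ℕ) : 0 ≤ level k := by
  unfold level
  have : (1 / 2 : ℝ) ^ k ≤ 1 := pow_le_one₀ (by norm_num) (by norm_num)
  linarith

lemma level_lt_one (k : ℕ) : level k < 1 := by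
  unfold level
  have : (0 : ℝ) < (1 / 2 : ℝ) ^ k := by positivity
  linarith

lemma level_succ (k : ℕ) : 2 * level (k + 1) - 1 = level k := by
  unfold level; ring

lemma tripleT_zero {d : ℕ} (x : ℝ) (b : ℤˣ) (u w : Fin d → ℝ) :
    tripleT x b u w 0 = pointA (signVal b * x) (-rho x • w + √(1 - rho x ^ 2) • u) := by
  rw [pointA, perp_add, perp_smul, perp_smul]
  simp [tripleT, mul_pow, signVal_sq]

lemma tripleT_one {d : ℕ} (x : ℝ) (b : ℤˣ) (u w : Fin d → ℝ) :
    tripleT x b u w 1 = pointA (signVal b * x) (-rho x • w + √(1 - rho x ^ 2) • -u) := by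
  have h : perp (-u) = -perp u := by simpa using perp_smul (-1) u
  rw [pointA, perp_add, perp_smul, perp_smul, h]
  simp [tripleT, mul_pow, signVal_sq, sub_eq_add_neg]

lemma tripleT_two {d : ℕ} {x : ℝ} (hx : 0 ≤ x) (b : ℤˣ) (u w : Fin d → ℝ) :
    tripleT x b u w 2 = pointA (signVal (-b) * (2 * x - 1)) w := by
  simp only [tripleT, pointA, mul_pow, signVal_sq, abs_of_nonneg hx, signVal_neg, one_mul, neg_sq,
    Matrix.cons_val]
  congr 2; ring

lemma measurable_perp {d : ℕ} : Measurable (perp : (Fin d → ℝ) → Space d) := by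
  refine (WithLp.measurable_toLp 2 _).comp (measurable_pi_iff.2 fun i => ?_)
  refine Fin.lastCases ?_ (fun j => ?_) i
  · simp
  · simp; fun_prop

lemma measurable_pointA {d : ℕ} (y : ℝ) : Measurable (pointA (d := d) y) := by
  unfold pointA
  exact ((measurable_perp (d := d)).const_smul (√(1 - y ^ 2))).const_add _

/-! ### Soundness -/

namespace Discretization

variable {ε : ℝ} {d : ℕ} (D : Discretization ε d)

/-- The points `w` at which `f` disagrees with the sign `b` on the level `b (1 - 2^{-k})`. -/
def minority (f : D.Var → ℤˣ) (b : ℤˣ) (k : ℕ) : Set (Fin d → ℝ) :=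
  {w | f (D.round (pointA (signVal b * level k) w)) = -b}

/-- The samples of kind `κ` whose constraint is violated by `f`. -/
def violated (f : D.Var → ℤˣ) (κ : Kind ε) : Set ((Fin d → ℝ) × (Fin d → ℝ)) :=
  {p | (fun i => (D.clause κ p.1 p.2 i).eval f) ∉ notAllEqual}

lemma measurableSet_minority (f : D.Var → ℤˣ) (b : ℤˣ) (k : ℕ) :
    MeasurableSet (D.minority f b k) := by
  have h : D.minority f b k = ⋃ r ∈ {r | f ⟨D.center r, Set.mem_range_self r⟩ = -b},
      pointA (signVal b * level k) ⁻¹' (D.region ⁻¹' {r}) := by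
    ext w; simp [minority, round]
  rw [h]
  exact MeasurableSet.biUnion (Set.to_countable _) fun r _ =>
    measurable_pointA _ (D.measurableSet_region r)

/-- All three points get the value `b`: the first two agree with the sign of their level, and the
third disagrees with `-b`. The identity `2 * level (j + 1) - 1 = level j` puts the third one on the
next lower level. -/
lemma mem_violated_some {f : D.Var → ℤˣ} {b : ℤˣ} {j : Fin (k₀ ε)} {u w : Fin d → ℝ}
    (h0 : -rho (level (j + 1)) • w + √(1 - rho (level (j + 1)) ^ 2) • u ∉ D.minority f b (j + 1))
    (h1 : -rho (level (j + 1)) • w + √(1 - rho (level (j + 1)) ^ 2) • -u ∉ D.minority f b (j + 1))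
    (h2 : w ∈ D.minority f (-b) j) : (u, w) ∈ D.violated f (some j, b) := by
  have key : ∀ s : ℤˣ, s ≠ -b → s = b := fun s hs => by
    rcases Int.units_eq_one_or s with rfl | rfl <;> rcases Int.units_eq_one_or b with rfl | rfl <;>
      simp_all
  have e0 := key _ h0
  have e1 := key _ h1
  have e2 : _ = - -b := h2
  rw [← level_succ, ← tripleT_two (level_nonneg _) b u w, neg_neg] at e2
  rw [← tripleT_zero] at e0
  rw [← tripleT_one] at e1
  have hall : ∀ i, (D.clause (some j, b) u w i).eval f = -b * b := by
    intro i
    simp only [clause, Literal.eval, Option.elim]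
    congr 1
    fin_cases i
    · exact e0
    · exact e1
    · exact e2
  rintro ⟨i, i', hne⟩
  exact hne ((hall i).trans (hall i').symm)

/-- For fixed `w ∈ B`, let `q` be the chance that the first point is in the minority; by the
symmetry `u ↦ -u` it is the same for the second. With `v` the chance of a violation, `1 ≤ 2q + v`,
so either `q ≥ 1/4` and `64 q³ ≥ 1`, or `v ≥ 1/2`. Integrating over `w` leaves `∫ q³`, which
hypercontractivity bounds. -/
lemma measure_minority_step (f : D.Var → ℤˣ) (b : ℤˣ) (j : Fin (k₀ ε)) :
    gauss d (D.minority f (-b) j) ≤ 64 * gauss d (D.minority f b (j + 1)) ^ (3 / 2 : ℝ)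
      + 2 * ((gauss d).prod (gauss d)) (D.violated f (some j, b)) := by
  set x := level (j + 1)
  set ρ := rho x
  set σ := √(1 - ρ ^ 2)
  set A := D.minority f b (j + 1)
  set B := D.minority f (-b) j
  have hA : MeasurableSet A := D.measurableSet_minority ..
  have hB : MeasurableSet B := D.measurableSet_minority ..
  have hρ2 : ρ ^ 2 ≤ 1 / 2 := rho_sq_le (level_nonneg _) (level_lt_one _)
  have hσ2 : ρ ^ 2 + σ ^ 2 = 1 := by rw [Real.sq_sqrt (by linarith)]; ring
  have hyp := gauss_noise_cube_le hA (rho_nonneg _) (Real.sqrt_nonneg _) hρ2 hσ2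
  set V : Set ((Fin d → ℝ) × (Fin d → ℝ)) :=
    {p | -ρ • p.2 + σ • p.1 ∈ Aᶜ ∧ -ρ • p.2 + σ • -p.1 ∈ Aᶜ ∧ p.2 ∈ B}
  have mp : Measurable fun p : (Fin d → ℝ) × (Fin d → ℝ) => -ρ • p.2 + σ • p.1 := by fun_prop
  have mn : Measurable fun p : (Fin d → ℝ) × (Fin d → ℝ) => -ρ • p.2 + σ • -p.1 := by fun_prop
  have hV : MeasurableSet V := (mp hA.compl).inter ((mn hA.compl).inter (measurable_snd hB))
  have hVsub : V ⊆ D.violated f (some j, b) := fun p hp => D.mem_violated_some hp.1 hp.2.1 hp.2.2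
  have mq : Measurable fun w => gauss d {u | -ρ • w + σ • u ∈ A} :=
    measurable_measure_prodMk_right (mp hA)
  have hneg : ∀ w, gauss d {u | -ρ • w + σ • -u ∈ A} = gauss d {u | -ρ • w + σ • u ∈ A} := by
    intro w
    have m0 : Measurable fun u : Fin d → ℝ => -ρ • w + σ • u := by fun_prop
    have m1 : Measurable fun u : Fin d → ℝ => -ρ • w + σ • -u := by fun_prop
    refine (lintegral_indicator_one (m1 hA)).symm.trans (Eq.trans ?_ (lintegral_indicator_one (m0 hA)))
    exact lintegral_comp_neg (measurable_one.indicator (m0 hA))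
  have hpt : ∀ w, B.indicator 1 w ≤ 64 * gauss d {u | -ρ • w + σ • u ∈ A} ^ 3
      + 2 * gauss d {u | (u, w) ∈ V} := by
    intro w
    by_cases hw : w ∈ B
    · rw [Set.indicator_of_mem hw, Pi.one_apply]
      have hcover : (1 : ℝ≥0∞) ≤ gauss d {u | -ρ • w + σ • u ∈ A}
          + gauss d {u | -ρ • w + σ • u ∈ A} + gauss d {u | (u, w) ∈ V} := by
        nth_rw 2 [← hneg w]
        calc (1 : ℝ≥0∞) = gauss d Set.univ := measure_univ.symm
          _ ≤ gauss d (({u | -ρ • w + σ • u ∈ A} ∪ {u | -ρ • w + σ • -u ∈ A}) ∪ {u | (u, w) ∈ V}) := by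
              refine measure_mono fun u _ => ?_
              by_cases h1 : -ρ • w + σ • u ∈ A
              · exact Or.inl (Or.inl h1)
              by_cases h2 : -ρ • w + σ • -u ∈ A
              · exact Or.inl (Or.inr h2)
              exact Or.inr ⟨h1, h2, hw⟩
          _ ≤ _ := (measure_union_le _ _).trans (by gcongr; exact measure_union_le _ _)
      rw [← ENNReal.toReal_le_toReal (by simp) (by finiteness)] at hcover ⊢
      rw [ENNReal.toReal_add (by finiteness) (by finiteness),
        ENNReal.toReal_add (by finiteness) (by finiteness)] at hcover
      rw [ENNReal.toReal_add (by finiteness) (by finiteness), ENNReal.toReal_mul,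
        ENNReal.toReal_mul, ENNReal.toReal_pow]
      simp only [ENNReal.toReal_one, ENNReal.toReal_ofNat] at hcover ⊢
      set q := (gauss d {u | -ρ • w + σ • u ∈ A}).toReal
      set v := (gauss d {u | (u, w) ∈ V}).toReal
      have hv0 : 0 ≤ v := ENNReal.toReal_nonneg
      have hq0 : 0 ≤ q := ENNReal.toReal_nonneg
      by_cases hq : 1 / 4 ≤ q
      · have : (1 / 4 : ℝ) ^ 3 ≤ q ^ 3 := by gcongr
        linarith
      · have : 0 ≤ q ^ 3 := by positivity
        linarith
    · rw [Set.indicator_of_notMem hw]; exact zero_le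
  calc gauss d B = ∫⁻ w, B.indicator 1 w ∂gauss d := (lintegral_indicator_one hB).symm
    _ ≤ ∫⁻ w, (64 * gauss d {u | -ρ • w + σ • u ∈ A} ^ 3 + 2 * gauss d {u | (u, w) ∈ V}) ∂gauss d :=
        lintegral_mono hpt
    _ = 64 * ∫⁻ w, gauss d {u | -ρ • w + σ • u ∈ A} ^ 3 ∂gauss d
          + 2 * ((gauss d).prod (gauss d)) V := by
        rw [lintegral_add_left (by fun_prop), lintegral_const_mul _ (by fun_prop),
          Measure.prod_apply_symm hV]
        congr 1
        exact lintegral_const_mul _ (measurable_measure_prodMk_right hV)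
    _ ≤ _ := by gcongr

/-- The threshold is `128⁻²`: below it `64 √q ≤ 1/2`, so the power term is at most `q / 2`. -/
lemma measureReal_minority_step (f : D.Var → ℤˣ) (b : ℤˣ) (j : Fin (k₀ ε))
    (h : (gauss d).real (D.minority f b (j + 1)) ≤ 1 / 16384) :
    (gauss d).real (D.minority f (-b) j) ≤ (gauss d).real (D.minority f b (j + 1))
      + 2 * ((gauss d).prod (gauss d)).real (D.violated f (some j, b)) := by
  have hstep := D.measure_minority_step f b j
  have h1 : gauss d (D.minority f b (j + 1)) ^ (3 / 2 : ℝ) ≠ ∞ := by finiteness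
  have := ENNReal.toReal_mono (by finiteness) hstep
  rw [ENNReal.toReal_add (by finiteness) (by finiteness), ENNReal.toReal_mul, ENNReal.toReal_mul,
    ← ENNReal.toReal_rpow] at this
  simp only [ENNReal.toReal_ofNat] at this
  change (gauss d).real _ ≤ 64 * (gauss d).real _ ^ (3 / 2 : ℝ)
    + 2 * ((gauss d).prod (gauss d)).real _ at this
  set q := (gauss d).real (D.minority f b (j + 1))
  have hq0 : 0 ≤ q := measureReal_nonneg
  have hs : √q ≤ 1 / 128 := by
    rw [Real.sqrt_le_left (by norm_num)]
    linarith
  have hpow : q ^ (3 / 2 : ℝ) = q * √q := by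
    rw [Real.sqrt_eq_rpow, show (3 / 2 : ℝ) = 1 + 1 / 2 by norm_num,
      Real.rpow_add_of_nonneg hq0 (by norm_num) (by norm_num), Real.rpow_one]
  have : q * √q ≤ q * (1 / 128) := by gcongr
  linarith

/-- For both signs `b` the two constant literals evaluate to `-1`, so a violation means `b * f p =
-1`. -/
lemma violated_none (f : D.Var → ℤˣ) (b : ℤˣ) :
    ((gauss d).prod (gauss d)).real (D.violated f (none, b))
      = (gauss d).real (D.minority f b (k₀ ε)) := by
  have : D.violated f (none, b) = Set.univ ×ˢ D.minority f b (k₀ ε) := by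
    ext ⟨u, w⟩
    simp only [violated, clause, notAllEqual, minority, Set.mem_ofPred_eq, Set.mem_prod, Set.mem_univ,
      true_and, Literal.eval, Fin.exists_fin_succ, not_or]
    rcases Int.units_eq_one_or b with rfl | rfl
    · simpa using fun h => h.symm
    · simpa using fun h => h.symm
  rw [this, measureReal_prod_prod]; simp

lemma sum_violated_ge (f : D.Var → ℤˣ) :
    1 / 32768 ≤ ∑ κ : Kind ε, ((gauss d).prod (gauss d)).real (D.violated f κ) := by
  set δ : Kind ε → ℝ := fun κ => ((gauss d).prod (gauss d)).real (D.violated f κ) with hδ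
  set q : ℤˣ → ℕ → ℝ := fun b k => (gauss d).real (D.minority f b k) with hq
  have hq0 : ∀ b k, 0 ≤ q b k := fun b k => measureReal_nonneg
  have hδ0 : ∀ κ, 0 ≤ δ κ := fun κ => measureReal_nonneg
  set Δ : ℕ → ℝ := fun j => if h : j < k₀ ε then δ (some ⟨j, h⟩, 1) + δ (some ⟨j, h⟩, -1) else 0
    with hΔ
  have hΔ0 : ∀ j, 0 ≤ Δ j := fun j => by
    simp only [hΔ]; split_ifs
    · exact add_nonneg (hδ0 _) (hδ0 _)
    · exact le_rfl
  have hunits : ∀ g : ℤˣ → ℝ, ∑ b, g b = g 1 + g (-1) := fun g => by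
    rw [show (Finset.univ : Finset ℤˣ) = {1, -1} from rfl]
    exact Finset.sum_pair (by decide)
  have htot : ∑ κ, δ κ = (q 1 (k₀ ε) + q (-1) (k₀ ε)) + ∑ j ∈ Finset.range (k₀ ε), Δ j := by
    rw [Fintype.sum_prod_type, Fintype.sum_option, hunits, ← Fin.sum_univ_eq_sum_range]
    congr 1
    · rw [hδ, hq]; simp only [D.violated_none]
    · refine Finset.sum_congr rfl fun j _ => ?_
      rw [hunits]; simp [hΔ]
  by_contra! hlt
  have hsum0 : ∀ k, 0 ≤ ∑ j ∈ Finset.Ico k (k₀ ε), Δ j := fun k =>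
    Finset.sum_nonneg fun j _ => hΔ0 j
  have hIco : ∀ k, ∑ j ∈ Finset.Ico k (k₀ ε), Δ j ≤ ∑ j ∈ Finset.range (k₀ ε), Δ j := fun k =>
    Finset.sum_le_sum_of_subset_of_nonneg
      (fun j hj => Finset.mem_range.2 (Finset.mem_Ico.1 hj).2) fun j _ _ => hΔ0 j
  -- The bound at level `k + 1` is at most twice the total violation, hence below `1/16384`, so the
  -- step lemma stays applicable on the way down.
  have hbound : ∀ k ≤ k₀ ε, q 1 k + q (-1) k
      ≤ (q 1 (k₀ ε) + q (-1) (k₀ ε)) + 2 * ∑ j ∈ Finset.Ico k (k₀ ε), Δ j := by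
    intro k hk
    induction hk using Nat.decreasingInduction with
    | self => simp
    | of_succ k hk ih =>
      have h2 := hIco (k + 1)
      have hsmall : q 1 (k + 1) + q (-1) (k + 1) ≤ 1 / 16384 := by
        linarith [hq0 1 (k₀ ε), hq0 (-1) (k₀ ε)]
      have s1 := D.measureReal_minority_step f 1 ⟨k, hk⟩ (by linarith [hq0 (-1) (k + 1)])
      have s2 := D.measureReal_minority_step f (-1) ⟨k, hk⟩ (by linarith [hq0 1 (k + 1)])
      rw [neg_neg] at s2
      rw [Finset.sum_eq_sum_Ico_succ_bot hk]
      have : Δ k = δ (some ⟨k, hk⟩, 1) + δ (some ⟨k, hk⟩, -1) := dif_pos hk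
      rw [this]
      simp only [hq, hδ] at ih ⊢
      linarith
  have h0 := hbound 0 (Nat.zero_le _)
  have hI := hIco 0
  -- At level 0 both signs give the same points, so the two minorities are complementary.
  have hone : q 1 0 + q (-1) 0 = 1 := by
    have hc : D.minority f (-1) 0 = (D.minority f 1 0)ᶜ := by
      ext w
      simp only [minority, level, pow_zero, sub_self, mul_zero, neg_neg, Set.mem_compl_iff,
        Set.mem_ofPred_eq]
      rcases Int.units_eq_one_or (f (D.round (pointA 0 w))) with hs | hs <;> simp [hs]
    simp only [hq, hc]
    rw [measureReal_add_measureReal_compl (D.measurableSet_minority f 1 0)]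
    simp
  linarith [hq0 1 (k₀ ε), hq0 (-1) (k₀ ε)]

/-- The violating samples are covered by the fibres of the finitely many violated clauses;
subadditivity suffices, so the fibres need not be shown measurable. -/
lemma sum_violated_le (f : D.Var → ℤˣ) :
    1 / (2 * ((k₀ ε : ℝ) + 1)) * ∑ κ : Kind ε, ((gauss d).prod (gauss d)).real (D.violated f κ)
      ≤ D.violatedWeight f := by
  set P := (gauss d).prod (gauss d)
  set c := 1 / (2 * ((k₀ ε : ℝ) + 1)) with hc
  have hc0 : 0 ≤ c := by positivity
  classical
  set S : Set (Clause D.Var) := {C | (fun i => (C i).eval f) ∉ notAllEqual}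
  have h1 : D.violatedWeight f
      = c * ∑ κ : Kind ε, ∑ C ∈ Finset.univ.filter (· ∈ S), P.real {p | D.clause κ p.1 p.2 = C} := by
    unfold violatedWeight weight sampleProb
    rw [Finset.sum_comm, Finset.mul_sum, Finset.sum_filter]
    refine Finset.sum_congr rfl fun C _ => ?_
    by_cases hC : C ∈ S
    · rw [Set.indicator_of_mem hC, if_pos hC, Finset.mul_sum]
    · rw [Set.indicator_of_notMem hC, if_neg hC]
  rw [h1]
  gcongr with κ
  have hsub : D.violated f κ ⊆ ⋃ C ∈ Finset.univ.filter (· ∈ S), {p | D.clause κ p.1 p.2 = C} := by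
    intro p hp
    simp only [Set.mem_iUnion]
    exact ⟨D.clause κ p.1 p.2, Finset.mem_filter.2 ⟨Finset.mem_univ _, hp⟩, rfl⟩
  exact (measureReal_mono hsub (measure_ne_top _ _)).trans (measureReal_biUnion_finset_le _ _)

theorem le_violatedWeight (hε₀ : 0 < ε) (hε₁ : ε < 1) (f : D.Var → ℤˣ) :
    1 / (10 ^ 60 * (⌈Real.logb 2 (1 / ε)⌉₊ : ℝ)) ≤ D.violatedWeight f := by
  refine le_trans ?_ (D.sum_violated_le f)
  have hK : (1 : ℝ) ≤ (⌈Real.logb 2 (1 / ε)⌉₊ : ℝ) := by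
    have : 0 < Real.logb 2 (1 / ε) := Real.logb_pos (by norm_num) (one_lt_one_div hε₀ hε₁)
    exact_mod_cast Nat.one_le_iff_ne_zero.2 (Nat.ceil_pos.2 this).ne'
  have hk : (k₀ ε : ℝ) = (⌈Real.logb 2 (1 / ε)⌉₊ : ℝ) + 20 := by unfold k₀; push_cast; rfl
  rw [hk]
  set K : ℝ := (⌈Real.logb 2 (1 / ε)⌉₊ : ℝ)
  calc 1 / (10 ^ 60 * K) ≤ 1 / (2 * (K + 20 + 1)) * (1 / 32768) := by
        rw [one_div_mul_one_div]
        apply one_div_le_one_div_of_le (by positivity)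
        linarith
    _ ≤ _ := by gcongr; exact D.sum_violated_ge f

end Discretization

/-! ### Concentration -/

lemma integral_exp_mul_sq_gaussianReal {v : NNReal} (hv : v ≠ 0) {s : ℝ} (hs : 2 * v * s < 1) :
    ∫ x, Real.exp (s * (x * x)) ∂gaussianReal 0 v = (√(1 - 2 * v * s))⁻¹ := by
  have hv0 : (0 : ℝ) < v := by positivity
  have hb : 0 < 1 / (2 * v) - s := by
    rw [sub_pos, lt_div_iff₀ (by positivity)]; linarith
  rw [integral_gaussianReal_eq_integral_smul hv]
  have h : ∀ x : ℝ, gaussianPDFReal 0 v x • Real.exp (s * (x * x))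
      = (√(2 * Real.pi * v))⁻¹ * Real.exp (-(1 / (2 * v) - s) * x ^ 2) := fun x => by
    rw [gaussianPDFReal, smul_eq_mul, mul_assoc, ← Real.exp_add]
    congr 2; ring
  simp_rw [h]
  rw [integral_const_mul, integral_gaussian, ← Real.sqrt_inv, ← Real.sqrt_mul (by positivity),
    ← Real.sqrt_inv]
  congr 1
  have : (1 - 2 * v * s) ≠ 0 := by linarith
  have h2 : (1 / (2 * v) - s : ℝ) = (1 - 2 * v * s) / (2 * v) := by field_simp
  rw [h2]
  field_simp

/-- This is `-log (1 - y) ≤ y + y²` for small `y`, halved and exponentiated. -/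
lemma inv_sqrt_one_sub_le_exp {y : ℝ} (hy : |y| ≤ 1 / 4) :
    (√(1 - y))⁻¹ ≤ Real.exp ((y + y ^ 2) / 2) := by
  obtain ⟨h1, h2⟩ := abs_le.1 hy
  have hpos : 0 < 1 - y := by linarith
  have key : Real.exp (-(y + y ^ 2)) ≤ 1 - y := by
    have hz : |-(y + y ^ 2)| ≤ 1 := by rw [abs_le]; constructor <;> nlinarith
    rcases le_total y 0 with h | h
    · have := (abs_le.1 (Real.abs_exp_sub_one_sub_id_le hz)).2
      have h3 : (y + y ^ 2) ^ 2 ≤ y ^ 2 := by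
        rw [sq_le_sq, abs_le]
        rw [abs_of_nonpos h]
        constructor <;> nlinarith
      nlinarith
    · rw [Real.exp_neg, inv_le_comm₀ (Real.exp_pos _) hpos]
      refine le_trans ?_ (Real.quadratic_le_exp_of_nonneg (by positivity))
      rw [inv_le_iff_one_le_mul₀ hpos]
      nlinarith [mul_nonneg h h, mul_nonneg (mul_nonneg h h) h, mul_nonneg (mul_nonneg h h) (sub_nonneg.2 h2),
        mul_nonneg (mul_nonneg (mul_nonneg h h) h) (sub_nonneg.2 h2)]
  rw [inv_le_comm₀ (Real.sqrt_pos.2 hpos) (Real.exp_pos _), ← Real.exp_neg]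
  refine Real.le_sqrt_of_sq_le ?_
  rw [← Real.exp_nat_mul]
  refine le_trans (le_of_eq ?_) key
  congr 1; push_cast; ring

lemma lintegral_exp_mul_dotProduct_self_le {d : ℕ} (hd : 0 < d) {s : ℝ} (hs : |2 * s / d| ≤ 1 / 4) :
    ∫⁻ w, ENNReal.ofReal (Real.exp (s * (w ⬝ᵥ w))) ∂gauss d
      ≤ ENNReal.ofReal (Real.exp (s + 2 * s ^ 2 / d)) := by
  have hd' : (0 : ℝ) < d := by exact_mod_cast hd
  have hlt := (abs_le.1 hs).2
  have hprod : ∀ w : Fin d → ℝ, Real.exp (s * (w ⬝ᵥ w)) = ∏ i, Real.exp (s * (w i * w i)) := fun w => by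
    rw [← Real.exp_sum, dotProduct, Finset.mul_sum]
  have h1 : ∫ w, Real.exp (s * (w ⬝ᵥ w)) ∂gauss d = (√(1 - 2 * s / d))⁻¹ ^ d := by
    simp_rw [hprod]
    rw [gauss, integral_fintype_prod_eq_pow (fun x => Real.exp (s * (x * x))),
      integral_exp_mul_sq_gaussianReal (by positivity), Fintype.card_fin]
    · congr 4; push_cast; ring
    · push_cast
      have : 2 * (1 / (d : ℝ)) * s = 2 * s / d := by ring
      linarith
  have hint : Integrable (fun w : Fin d → ℝ => Real.exp (s * (w ⬝ᵥ w))) (gauss d) := by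
    -- A non-integrable function would have integral 0 by convention, but the computed value is
    -- positive.
    by_contra h
    rw [integral_undef h] at h1
    have : 0 < (√(1 - 2 * s / d))⁻¹ ^ d := by
      have : 0 < 1 - 2 * s / d := by linarith
      positivity
    linarith
  rw [← ofReal_integral_eq_lintegral_ofReal hint (ae_of_all _ fun _ => (Real.exp_pos _).le), h1]
  refine ENNReal.ofReal_le_ofReal ?_
  calc (√(1 - 2 * s / d))⁻¹ ^ d ≤ Real.exp ((2 * s / d + (2 * s / d) ^ 2) / 2) ^ d := by
        gcongr; exact inv_sqrt_one_sub_le_exp hs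
    _ = _ := by
        rw [← Real.exp_nat_mul]; congr 1; field_simp

/-- The exponential Markov inequality. -/
lemma measureReal_le_exp_of_lintegral_le {α : Type*} [MeasurableSpace α] {μ : Measure α} {X : α → ℝ}
    (hX : Measurable X) {a b : ℝ}
    (h : ∫⁻ x, ENNReal.ofReal (Real.exp (X x)) ∂μ ≤ ENNReal.ofReal (Real.exp b)) :
    μ.real {x | a < X x} ≤ Real.exp (b - a) := by
  have hM := mul_meas_ge_le_lintegral (μ := μ) (f := fun x => ENNReal.ofReal (Real.exp (X x)))
    (by fun_prop) (ENNReal.ofReal (Real.exp a))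
  have h2 : μ {x | a < X x} ≤ ENNReal.ofReal (Real.exp (b - a)) := by
    rw [Real.exp_sub, ENNReal.ofReal_div_of_pos (Real.exp_pos _),
      ENNReal.le_div_iff_mul_le (by simp [Real.exp_pos]) (by simp), mul_comm]
    refine le_trans ?_ (hM.trans h)
    refine mul_le_mul_right (measure_mono fun x hx => ?_) _
    exact ENNReal.ofReal_le_ofReal (Real.exp_le_exp.2 (le_of_lt hx))
  exact ENNReal.toReal_le_of_le_ofReal (Real.exp_pos _).le h2

/-- Chernoff bound on both sides; `s = ± d t / 4` minimizes the exponent `2 s² / d - |s| t`. -/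
lemma gauss_norm_sq_tail {d : ℕ} (hd : 0 < d) {t : ℝ} (ht0 : 0 ≤ t) (ht1 : t ≤ 1 / 2) :
    (gauss d).real {w | t < |w ⬝ᵥ w - 1|} ≤ 2 * Real.exp (-(d * t ^ 2 / 8)) := by
  have hd' : (0 : ℝ) < d := by exact_mod_cast hd
  have hm : Measurable fun w : Fin d → ℝ => w ⬝ᵥ w := by unfold dotProduct; fun_prop
  have hb : ∀ c : ℝ, |c| = 1 → |2 * (c * (d * t / 4)) / d| ≤ 1 / 4 := fun c hc => by
    have : 2 * (c * (d * t / 4)) / d = c * (t / 2) := by field_simp; ring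
    rw [this, abs_mul, hc, abs_of_nonneg (by positivity)]; linarith
  have h1 := measureReal_le_exp_of_lintegral_le (hm.const_mul (1 * (d * t / 4)))
    (a := d * t / 4 * (1 + t)) (lintegral_exp_mul_dotProduct_self_le hd (hb 1 (by simp)))
  have h2 := measureReal_le_exp_of_lintegral_le (hm.const_mul (-1 * (d * t / 4)))
    (a := d * t / 4 * (t - 1)) (lintegral_exp_mul_dotProduct_self_le hd (hb (-1) (by simp)))
  have e1 : 1 * (d * t / 4) + 2 * (1 * (d * t / 4)) ^ 2 / d - d * t / 4 * (1 + t)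
      = -(d * t ^ 2 / 8) := by field_simp; ring
  have e2 : -1 * (d * t / 4) + 2 * (-1 * (d * t / 4)) ^ 2 / d - d * t / 4 * (t - 1)
      = -(d * t ^ 2 / 8) := by field_simp; ring
  rw [e1] at h1
  rw [e2] at h2
  rcases ht0.eq_or_lt with rfl | ht
  · refine measureReal_le_one.trans ?_
    simp
  have hpos : 0 < d * t / 4 := by positivity
  refine (measureReal_mono (s₂ := {w | d * t / 4 * (1 + t) < 1 * (d * t / 4) * (w ⬝ᵥ w)} ∪
    {w | d * t / 4 * (t - 1) < -1 * (d * t / 4) * (w ⬝ᵥ w)}) ?_ (measure_ne_top _ _)).trans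
    ((measureReal_union_le _ _).trans (by linarith))
  intro w hw
  rcases lt_abs.1 (show t < |w ⬝ᵥ w - 1| from hw) with h | h
  · left
    change d * t / 4 * (1 + t) < 1 * (d * t / 4) * (w ⬝ᵥ w)
    rw [one_mul]; exact mul_lt_mul_of_pos_left (by linarith) hpos
  · right
    change d * t / 4 * (t - 1) < -1 * (d * t / 4) * (w ⬝ᵥ w)
    have := mul_lt_mul_of_pos_left (show t - 1 < -(w ⬝ᵥ w) by linarith) hpos
    linarith

/-- After a rotation by `π / 4`, the product `w · u` becomes `(‖x‖² - ‖y‖²) / 2` with `x, y`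
independent, which reduces to the moments of squared norms. -/
lemma lintegral_exp_mul_dotProduct_le {d : ℕ} (hd : 0 < d) {s : ℝ} (hs : |s / d| ≤ 1 / 4) :
    ∫⁻ p : (Fin d → ℝ) × (Fin d → ℝ), ENNReal.ofReal (Real.exp (s * (p.2 ⬝ᵥ p.1)))
        ∂(gauss d).prod (gauss d)
      ≤ ENNReal.ofReal (Real.exp (s ^ 2 / d)) := by
  have hm0 : Measurable fun w : Fin d → ℝ => w ⬝ᵥ w := by unfold dotProduct; fun_prop
  have hm : Measurable fun p : (Fin d → ℝ) × (Fin d → ℝ) => p.2 ⬝ᵥ p.1 := by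
    unfold dotProduct; fun_prop
  have hr2 : √(1 / 2 : ℝ) * √(1 / 2 : ℝ) = 1 / 2 := Real.mul_self_sqrt (by norm_num)
  rw [lintegral_prod _ (by fun_prop), lintegral_hadamard
    (F := fun x y => ENNReal.ofReal (Real.exp (s * (y ⬝ᵥ x)))) (by unfold Function.uncurry; fun_prop)
    (Real.sqrt_nonneg (1 / 2)) (Real.sq_sqrt (by norm_num))]
  have hfac : ∀ x y : Fin d → ℝ,
      ENNReal.ofReal (Real.exp (s * ((√(1 / 2 : ℝ) • (x - y)) ⬝ᵥ (√(1 / 2 : ℝ) • (x + y)))))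
      = ENNReal.ofReal (Real.exp (s / 2 * (x ⬝ᵥ x)))
        * ENNReal.ofReal (Real.exp (-(s / 2) * (y ⬝ᵥ y))) := fun x y => by
    rw [← ENNReal.ofReal_mul (Real.exp_pos _).le, ← Real.exp_add]
    congr 2
    rw [smul_dotProduct, dotProduct_smul, smul_smul, hr2, sub_dotProduct, dotProduct_add,
      dotProduct_add, dotProduct_comm y x, smul_eq_mul]
    ring
  simp_rw [hfac]
  have e1 : ∀ x : Fin d → ℝ, ∫⁻ y, ENNReal.ofReal (Real.exp (s / 2 * (x ⬝ᵥ x)))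
        * ENNReal.ofReal (Real.exp (-(s / 2) * (y ⬝ᵥ y))) ∂gauss d
      = ENNReal.ofReal (Real.exp (s / 2 * (x ⬝ᵥ x)))
        * ∫⁻ y, ENNReal.ofReal (Real.exp (-(s / 2) * (y ⬝ᵥ y))) ∂gauss d := fun x =>
    lintegral_const_mul _ (by fun_prop)
  simp_rw [e1]
  rw [lintegral_mul_const _ (by fun_prop)]
  have h1 := lintegral_exp_mul_dotProduct_self_le hd (s := s / 2) (by convert hs using 3; ring)
  have h2 := lintegral_exp_mul_dotProduct_self_le hd (s := -(s / 2))
    (by rw [← abs_neg]; convert hs using 2; ring)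
  refine (mul_le_mul' h1 h2).trans (le_of_eq ?_)
  rw [← ENNReal.ofReal_mul (Real.exp_pos _).le, ← Real.exp_add]
  congr 2; ring

lemma gauss_dotProduct_tail {d : ℕ} (hd : 0 < d) {t : ℝ} (ht0 : 0 ≤ t) (ht1 : t ≤ 1 / 2) :
    ((gauss d).prod (gauss d)).real {p | t < |p.2 ⬝ᵥ p.1|} ≤ 2 * Real.exp (-(d * t ^ 2 / 8)) := by
  have hd' : (0 : ℝ) < d := by exact_mod_cast hd
  have hm : Measurable fun p : (Fin d → ℝ) × (Fin d → ℝ) => p.2 ⬝ᵥ p.1 := by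
    unfold dotProduct; fun_prop
  have hb : ∀ c : ℝ, |c| = 1 → |c * (d * t / 2) / d| ≤ 1 / 4 := fun c hc => by
    have : c * (d * t / 2) / d = c * (t / 2) := by field_simp
    rw [this, abs_mul, hc, abs_of_nonneg (by positivity)]; linarith
  have h1 := measureReal_le_exp_of_lintegral_le (hm.const_mul (1 * (d * t / 2)))
    (a := d * t / 2 * t) (lintegral_exp_mul_dotProduct_le hd (hb 1 (by simp)))
  have h2 := measureReal_le_exp_of_lintegral_le (hm.const_mul (-1 * (d * t / 2)))
    (a := d * t / 2 * t) (lintegral_exp_mul_dotProduct_le hd (hb (-1) (by simp)))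
  have e : Real.exp (-(d * t ^ 2 / 4)) ≤ Real.exp (-(d * t ^ 2 / 8)) := by
    rw [Real.exp_le_exp]
    have : 0 ≤ d * t ^ 2 := by positivity
    linarith
  have e1 : (1 * (d * t / 2)) ^ 2 / d - d * t / 2 * t = -(d * t ^ 2 / 4) := by field_simp; ring
  have e2 : (-1 * (d * t / 2)) ^ 2 / d - d * t / 2 * t = -(d * t ^ 2 / 4) := by field_simp; ring
  rw [e1] at h1
  rw [e2] at h2
  rcases ht0.eq_or_lt with rfl | ht
  · refine measureReal_le_one.trans ?_
    simp
  have hpos : 0 < d * t / 2 := by positivity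
  refine (measureReal_mono (s₂ := {p | d * t / 2 * t < 1 * (d * t / 2) * (p.2 ⬝ᵥ p.1)} ∪
    {p | d * t / 2 * t < -1 * (d * t / 2) * (p.2 ⬝ᵥ p.1)}) ?_ (measure_ne_top _ _)).trans
    ((measureReal_union_le _ _).trans (by linarith))
  intro p hp
  rcases lt_abs.1 (show t < |p.2 ⬝ᵥ p.1| from hp) with h | h
  · left
    change d * t / 2 * t < 1 * (d * t / 2) * (p.2 ⬝ᵥ p.1)
    rw [one_mul]; exact mul_lt_mul_of_pos_left h hpos
  · right
    change d * t / 2 * t < -1 * (d * t / 2) * (p.2 ⬝ᵥ p.1)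
    have := mul_lt_mul_of_pos_left h hpos
    linarith

theorem sampleProb_discarded_le {ε : ℝ} (hε₀ : 0 < ε) (hε₁ : ε < 1) {d : ℕ}
    (hd : 80000000 / ε ^ 3 ≤ (d : ℝ)) :
    sampleProb ε d (Discarded ε) ≤ 6 * Real.exp (-10 / ε) := by
  have hd' : (0 : ℝ) < d := lt_of_lt_of_le (by positivity) hd
  have hd0 : 0 < d := by exact_mod_cast hd'
  set t := ε / 1000 with ht
  have ht0 : 0 ≤ t := by positivity
  have ht1 : t ≤ 1 / 2 := by rw [ht]; linarith
  -- The constant in the bound on `d` is `8 * 10 * 1000²`. Three events of probability at most `2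
  -- exp(-10/ε)` give the factor 6.
  have hexp : Real.exp (-(d * t ^ 2 / 8)) ≤ Real.exp (-10 / ε) := by
    rw [Real.exp_le_exp, neg_div, neg_le_neg_iff, div_le_iff₀ hε₀]
    rw [div_le_iff₀ (by positivity)] at hd
    rw [ht]
    linarith
  have h1 := gauss_norm_sq_tail hd0 ht0 ht1
  have h2 := gauss_dotProduct_tail hd0 ht0 ht1
  set P := (gauss d).prod (gauss d) with hP
  set S : Set (Fin d → ℝ) := {w | t < |w ⬝ᵥ w - 1|}
  have hκ : ∀ κ : Kind ε, P.real {p | Discarded ε κ p.1 p.2} ≤ 6 * Real.exp (-10 / ε) := fun κ => by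
    have hw : P.real (Set.univ ×ˢ S) = (gauss d).real S := by rw [measureReal_prod_prod]; simp
    have hu : P.real (S ×ˢ Set.univ) = (gauss d).real S := by rw [measureReal_prod_prod]; simp
    refine (measureReal_mono (s₂ := (Set.univ ×ˢ S ∪ S ×ˢ Set.univ) ∪ {p | t < |p.2 ⬝ᵥ p.1|}) ?_
      (measure_ne_top _ _)).trans ((measureReal_union_le _ _).trans ?_)
    · rintro p (h | ⟨-, h | h⟩)
      · exact Or.inl (Or.inl ⟨trivial, h⟩)
      · exact Or.inl (Or.inr ⟨h, trivial⟩)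
      · exact Or.inr h
    · have := measureReal_union_le (μ := P) (Set.univ ×ˢ S) (S ×ˢ Set.univ)
      linarith
  calc sampleProb ε d (Discarded ε)
      ≤ ∑ _κ : Kind ε, 1 / (2 * ((k₀ ε : ℝ) + 1)) * (6 * Real.exp (-10 / ε)) := by
        unfold sampleProb; gcongr with κ; exact hκ κ
    _ = 6 * Real.exp (-10 / ε) := by
        rw [Finset.sum_const, Finset.card_univ, Fintype.card_prod, Fintype.card_option,
          Fintype.card_fin, Fintype.card_units_int]
        rw [nsmul_eq_mul]
        push_cast
        field_simp

/-! ### Existence of discretizations -/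

/-- By compactness finitely many points of a dense sequence form a net of the ball; the regions are
the measurable cells of nearest points, cut to the ball. -/
theorem nonempty_discretization {ε : ℝ} (hε₀ : 0 < ε) (d : ℕ) : Nonempty (Discretization ε d) := by
  classical
  set e := TopologicalSpace.denseSeq (Space d)
  have hcov : Metric.closedBall (0 : Space d) 2 ⊆ ⋃ n, Metric.ball (e n) (ε / 1000) := by
    intro v _
    obtain ⟨_, ⟨n, rfl⟩, hy⟩ := Metric.mem_closure_iff.1 (TopologicalSpace.denseRange_denseSeq _ v)
      (ε / 1000) (by positivity)
    exact Set.mem_iUnion.2 ⟨n, Metric.mem_ball.2 hy⟩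
  obtain ⟨s, hs⟩ := (isCompact_closedBall (0 : Space d) 2).elim_finite_subcover _
    (fun _ => Metric.isOpen_ball) hcov
  set N := s.sup id
  set ind := SimpleFunc.nearestPtInd e N
  have hind : ∀ v, ind v < N + 1 := fun v => Nat.lt_succ_of_le (SimpleFunc.nearestPtInd_le e N v)
  set region : Space d → Option (Fin (N + 1)) := fun v => if 2 < ‖v‖ then none else some ⟨ind v, hind v⟩
    with hregion
  have hmeas : MeasurableSet {v : Space d | 2 < ‖v‖} := measurableSet_lt measurable_const measurable_norm
  refine ⟨⟨N + 1, region, fun r => ?_, fun v => by simp [hregion], fun r => r.elim 0 fun i => e i,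
    fun v hv => ?_⟩⟩
  · cases r with
    | none => convert hmeas using 1; ext v; simp [hregion]
    | some i =>
      have : region ⁻¹' {some i} = {v | 2 < ‖v‖}ᶜ ∩ ind ⁻¹' {(i : ℕ)} := by
        ext v
        by_cases h : 2 < ‖v‖ <;> simp [hregion, h, Fin.ext_iff]
      rw [this]
      exact hmeas.compl.inter (ind.measurableSet_fiber _)
  · have hr : region v = some ⟨ind v, hind v⟩ := if_neg (not_lt.2 hv)
    rw [hr]
    obtain ⟨n, hn, hvn⟩ := Set.mem_iUnion₂.1 (hs (mem_closedBall_zero_iff.2 hv))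
    have h1 := SimpleFunc.edist_nearestPt_le e v (k := n) (N := N) (Finset.le_sup (f := id) hn)
    rw [edist_dist, edist_dist, ENNReal.ofReal_le_ofReal_iff dist_nonneg] at h1
    rw [dist_comm]
    rw [Metric.mem_ball, dist_comm] at hvn
    exact h1.trans hvn.le

/-! ### Local distributions -/

lemma sum_signs {F : (Fin 3 → ℤˣ) → ℝ} :
    ∑ a, F a = F ![1, 1, 1] + F ![1, 1, -1] + F ![1, -1, 1] + F ![1, -1, -1]
      + F ![-1, 1, 1] + F ![-1, 1, -1] + F ![-1, -1, 1] + F ![-1, -1, -1] := by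
  have : (Finset.univ : Finset (Fin 3 → ℤˣ)) = {![1, 1, 1], ![1, 1, -1], ![1, -1, 1], ![1, -1, -1],
      ![-1, 1, 1], ![-1, 1, -1], ![-1, -1, 1], ![-1, -1, -1]} := by decide
  rw [this]
  repeat rw [Finset.sum_insert (by decide)]
  rw [Finset.sum_singleton]
  ring

lemma forall_signs {Q : (Fin 3 → ℤˣ) → Prop} (h₁ : Q ![1, 1, 1]) (h₂ : Q ![1, 1, -1])
    (h₃ : Q ![1, -1, 1]) (h₄ : Q ![1, -1, -1]) (h₅ : Q ![-1, 1, 1]) (h₆ : Q ![-1, 1, -1])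
    (h₇ : Q ![-1, -1, 1]) (h₈ : Q ![-1, -1, -1]) (a : Fin 3 → ℤˣ) : Q a := by
  have : a = ![a 0, a 1, a 2] := by ext i; fin_cases i <;> rfl
  rw [this]
  rcases Int.units_eq_one_or (a 0) with h | h <;> rcases Int.units_eq_one_or (a 1) with h' | h' <;>
    rcases Int.units_eq_one_or (a 2) with h'' | h'' <;> rw [h, h', h''] <;> assumption

@[simp] lemma signVal_one : signVal 1 = 1 := by simp [signVal]

@[simp] lemma signVal_neg_one : signVal (-1) = -1 := by simp [signVal]

lemma mem_oneInThree₁ : ![1, -1, -1] ∈ oneInThree :=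
  ⟨0, rfl, by decide⟩

lemma mem_oneInThree₂ : ![-1, 1, -1] ∈ oneInThree :=
  ⟨1, rfl, by decide⟩

lemma mem_oneInThree₃ : ![-1, -1, 1] ∈ oneInThree :=
  ⟨2, rfl, by decide⟩

lemma le_sum_oneInThree {μ : (Fin 3 → ℤˣ) → ℝ} (h : ∀ a, 0 ≤ μ a) :
    μ ![1, -1, -1] + μ ![-1, 1, -1] + μ ![-1, -1, 1] ≤ ∑ a, oneInThree.indicator μ a := by
  have h0 : ∀ a, 0 ≤ oneInThree.indicator μ a := fun a => Set.indicator_nonneg (fun a _ => h a) a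
  rw [sum_signs, Set.indicator_of_mem mem_oneInThree₁, Set.indicator_of_mem mem_oneInThree₂,
    Set.indicator_of_mem mem_oneInThree₃]
  linarith [h0 ![1, 1, 1], h0 ![1, 1, -1], h0 ![1, -1, 1], h0 ![-1, 1, 1], h0 ![-1, -1, -1]]

/-- The uniform part gives every string mass `η / 8`, and errors of size `δ` in six Fourier
coefficients change a mass by at most `6δ / 8`. -/
lemma isApproxVectorAssignment_of_near {N : ℕ} {ε : ℝ} {v₀ : EuclideanSpace ℝ (Fin N)}
    {v : Fin 3 → EuclideanSpace ℝ (Fin N)} (hv : ∀ i, ‖v i‖ = 1) {η δ x : ℝ} (hx0 : 0 ≤ x)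
    (hx1 : x ≤ 1) (hη : η ≤ 1) (hδη : 6 * δ ≤ η) (hηε : η ≤ ε)
    (h0 : |inner ℝ v₀ (v 0) + (1 - η) * x| ≤ δ) (h1 : |inner ℝ v₀ (v 1) + (1 - η) * x| ≤ δ)
    (h2 : |inner ℝ v₀ (v 2) - (1 - η) * (2 * x - 1)| ≤ δ)
    (h01 : |inner ℝ (v 0) (v 1) - (1 - η) * (2 * x - 1)| ≤ δ)
    (h02 : |inner ℝ (v 0) (v 2) + (1 - η) * x| ≤ δ)
    (h12 : |inner ℝ (v 1) (v 2) + (1 - η) * x| ≤ δ) :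
    IsApproxVectorAssignment oneInThree ε v₀ v := by
  have hX0 : 0 ≤ (1 - η) * x := mul_nonneg (by linarith) hx0
  have hX1 : (1 - η) * x ≤ 1 - η := mul_le_of_le_one_right (by linarith) hx1
  have e : (1 - η) * (2 * x - 1) = 2 * ((1 - η) * x) - (1 - η) := by ring
  rw [e] at h2 h01
  obtain ⟨h0, h0'⟩ := abs_le.1 h0
  obtain ⟨h1, h1'⟩ := abs_le.1 h1
  obtain ⟨h2, h2'⟩ := abs_le.1 h2
  obtain ⟨h01, h01'⟩ := abs_le.1 h01
  obtain ⟨h02, h02'⟩ := abs_le.1 h02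
  obtain ⟨h12, h12'⟩ := abs_le.1 h12
  -- Fourier inversion. The free third coefficient is `1 - η`, because a string with exactly one `1`
  -- has product 1.
  set μ : (Fin 3 → ℤˣ) → ℝ := fun a => (1 + inner ℝ v₀ (v 0) * signVal (a 0)
    + inner ℝ v₀ (v 1) * signVal (a 1) + inner ℝ v₀ (v 2) * signVal (a 2)
    + inner ℝ (v 0) (v 1) * (signVal (a 0) * signVal (a 1))
    + inner ℝ (v 0) (v 2) * (signVal (a 0) * signVal (a 2))
    + inner ℝ (v 1) (v 2) * (signVal (a 1) * signVal (a 2))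
    + (1 - η) * (signVal (a 0) * signVal (a 1) * signVal (a 2))) / 8 with hμ
  have hnonneg : ∀ a, 0 ≤ μ a := by
    apply forall_signs <;> simp [hμ] <;> linarith
  refine ⟨μ, ⟨hnonneg, ?_, fun i => ?_, fun i j => ?_⟩, le_trans ?_ (le_sum_oneInThree hnonneg)⟩
  · rw [sum_signs]; simp [hμ]; ring
  · rw [sum_signs]; fin_cases i <;> simp [hμ] <;> ring
  · rw [sum_signs]
    fin_cases i <;> fin_cases j <;> simp [hμ, hv, real_inner_comm (v 0) (v 1),
      real_inner_comm (v 0) (v 2), real_inner_comm (v 1) (v 2)] <;> ring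
  · simp [hμ]; linarith

/-- Equal vectors force `a 0 = a 1`, so the moments determine a distribution on the two remaining
bits; the first, second, third and last-two hypotheses concern its four masses. -/
lemma isApproxVectorAssignment_of_eq {N : ℕ} {ε : ℝ} {v₀ : EuclideanSpace ℝ (Fin N)}
    {v : Fin 3 → EuclideanSpace ℝ (Fin N)} (hv : ∀ i, ‖v i‖ = 1) (heq : v 1 = v 0)
    (h₁ : 0 ≤ 1 + inner ℝ v₀ (v 0) + inner ℝ v₀ (v 2) + inner ℝ (v 0) (v 2))
    (h₂ : 0 ≤ 1 + inner ℝ v₀ (v 0) - inner ℝ v₀ (v 2) - inner ℝ (v 0) (v 2))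
    (h₃ : 0 ≤ 1 - inner ℝ v₀ (v 0) - inner ℝ v₀ (v 2) + inner ℝ (v 0) (v 2))
    (h₄ : 4 * (1 - ε) ≤ 1 - inner ℝ v₀ (v 0) + inner ℝ v₀ (v 2) - inner ℝ (v 0) (v 2))
    (h₅ : 0 ≤ 1 - inner ℝ v₀ (v 0) + inner ℝ v₀ (v 2) - inner ℝ (v 0) (v 2)) :
    IsApproxVectorAssignment oneInThree ε v₀ v := by
  set μ : (Fin 3 → ℤˣ) → ℝ := fun a => (1 + signVal (a 0) * signVal (a 1))
    * (1 + inner ℝ v₀ (v 0) * signVal (a 0) + inner ℝ v₀ (v 2) * signVal (a 2)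
      + inner ℝ (v 0) (v 2) * (signVal (a 0) * signVal (a 2))) / 8 with hμ
  have hnonneg : ∀ a, 0 ≤ μ a := by
    apply forall_signs <;> simp [hμ] <;> linarith
  refine ⟨μ, ⟨hnonneg, ?_, fun i => ?_, fun i j => ?_⟩, le_trans ?_ (le_sum_oneInThree hnonneg)⟩
  · rw [sum_signs]; simp [hμ]; ring
  · rw [sum_signs]; fin_cases i <;> simp [hμ, heq] <;> ring
  · rw [sum_signs]
    fin_cases i <;> fin_cases j <;> simp [hμ, hv, heq, real_inner_comm (v 0) (v 2)] <;> ring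
  · simp [hμ]; linarith

/-! ### Vectors with independent noise -/

/-- Each vector is `√(1-η)` times the given one plus `√η` times its own basis vector of a further
orthogonal space. Lengths survive, and all other inner products shrink by `1 - η`. -/
lemma exists_noisy_vectors {E V : Type} [NormedAddCommGroup E] [InnerProductSpace ℝ E]
    [FiniteDimensional ℝ E] [Fintype V] {e : E} (he : ‖e‖ = 1) {h : V → E} (hh : ∀ c, ‖h c‖ = 1)
    {η : ℝ} (hη0 : 0 ≤ η) (hη1 : η ≤ 1) :
    ∃ (N : ℕ) (v₀ : EuclideanSpace ℝ (Fin N)) (v : V → EuclideanSpace ℝ (Fin N)),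
      ‖v₀‖ = 1 ∧ (∀ c, ‖v c‖ = 1) ∧ (∀ c, inner ℝ v₀ (v c) = (1 - η) * inner ℝ e (h c)) ∧
        ∀ c c', c ≠ c' → inner ℝ (v c) (v c') = (1 - η) * inner ℝ (h c) (h c') := by
  classical
  let W := WithLp 2 (E × EuclideanSpace ℝ (Option V))
  have : FiniteDimensional ℝ W := inferInstance
  let n : Option V → EuclideanSpace ℝ (Option V) := fun o => EuclideanSpace.single o 1
  let H : Option V → E := fun o => o.elim e h
  let z : Option V → W := fun o => WithLp.toLp 2 (√(1 - η) • H o, √η • n o)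
  have hz : ∀ o o', inner ℝ (z o) (z o')
      = (1 - η) * inner ℝ (H o) (H o') + if o = o' then η else 0 := fun o o' => by
    have hn : inner ℝ (n o) (n o') = if o = o' then (1 : ℝ) else 0 :=
      orthonormal_iff_ite.1 (EuclideanSpace.orthonormal_single (𝕜 := ℝ)) o o'
    rw [show inner ℝ (z o) (z o') = inner ℝ (√(1 - η) • H o) (√(1 - η) • H o')
      + inner ℝ (√η • n o) (√η • n o') from WithLp.prod_inner_apply _ _, real_inner_smul_left,
      real_inner_smul_right, real_inner_smul_left, real_inner_smul_right, hn, ← mul_assoc,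
      ← mul_assoc, Real.mul_self_sqrt hη0, Real.mul_self_sqrt (sub_nonneg.2 hη1), mul_ite, mul_one,
      mul_zero]
  have hH : ∀ o, ‖H o‖ = 1 := fun o => by cases o <;> simp [H, he, hh]
  have hz1 : ∀ o, ‖z o‖ = 1 := fun o => by
    have := hz o o
    rw [real_inner_self_eq_norm_sq, real_inner_self_eq_norm_sq, hH, if_pos rfl] at this
    have h2 : ‖z o‖ ^ 2 = 1 := by linarith
    exact (pow_eq_one_iff_of_nonneg (norm_nonneg _) two_ne_zero).1 h2
  let φ := (stdOrthonormalBasis ℝ W).repr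
  refine ⟨_, φ (z none), fun c => φ (z (some c)), ?_, fun c => ?_, fun c => ?_, fun c c' hc => ?_⟩
  · rw [LinearIsometryEquiv.norm_map, hz1]
  · rw [LinearIsometryEquiv.norm_map, hz1]
  · rw [LinearIsometryEquiv.inner_map_map, hz]; simp [H]
  · rw [LinearIsometryEquiv.inner_map_map, hz, if_neg (by simpa using hc)]; simp [H]

/-! ### Inner products of the sampled vectors -/

lemma norm_e₀ (d : ℕ) : ‖e₀ d‖ = 1 := by simp [e₀]

lemma inner_e₀_perp {d : ℕ} (w : Fin d → ℝ) : inner ℝ (e₀ d) (perp w) = (0 : ℝ) := by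
  simp [e₀, perp, EuclideanSpace.inner_single_left]

lemma inner_perp_perp {d : ℕ} (u w : Fin d → ℝ) : inner ℝ (perp u) (perp w) = u ⬝ᵥ w := by
  simp [perp, PiLp.inner_apply, Fin.sum_univ_castSucc, dotProduct, mul_comm]

lemma inner_e₀_pointA {d : ℕ} (y : ℝ) (w : Fin d → ℝ) : inner ℝ (e₀ d) (pointA y w) = y := by
  rw [pointA, inner_add_right, inner_smul_right, inner_smul_right, inner_e₀_perp,
    real_inner_self_eq_norm_sq, norm_e₀]
  ring

lemma inner_pointA {d : ℕ} (y y' : ℝ) (w w' : Fin d → ℝ) :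
    inner ℝ (pointA y w) (pointA y' w') = y * y' + √(1 - y ^ 2) * √(1 - y' ^ 2) * (w ⬝ᵥ w') := by
  have h := inner_e₀_perp (d := d)
  have h' : ∀ w : Fin d → ℝ, inner ℝ (perp w) (e₀ d) = (0 : ℝ) := fun w => by
    rw [real_inner_comm, h]
  simp only [pointA, inner_add_left, inner_add_right, real_inner_smul_left, real_inner_smul_right,
    h, h', inner_perp_perp, real_inner_self_eq_norm_sq, norm_e₀]
  ring

/-- The exact inner products of a triple. -/
structure TripleMoments (d : ℕ) (x s a g h K : ℝ) (p : Fin 3 → Space d) : Prop where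
  e0 : inner ℝ (e₀ d) (p 0) = s * x
  e1 : inner ℝ (e₀ d) (p 1) = s * x
  e2 : inner ℝ (e₀ d) (p 2) = -s * (2 * x - 1)
  p00 : inner ℝ (p 0) (p 0) = 1 + x * (1 - x) * (a - 1) + (1 - x) * (h - 1) - 2 * K * g
  p11 : inner ℝ (p 1) (p 1) = 1 + x * (1 - x) * (a - 1) + (1 - x) * (h - 1) + 2 * K * g
  p22 : inner ℝ (p 2) (p 2) = 1 + 4 * (x * (1 - x)) * (a - 1)
  p01 : inner ℝ (p 0) (p 1) = (2 * x - 1) + x * (1 - x) * (a - 1) - (1 - x) * (h - 1)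
  p02 : inner ℝ (p 0) (p 2) = -x - 2 * (x * (1 - x)) * (a - 1) + 2 * K * g
  p12 : inner ℝ (p 1) (p 2) = -x - 2 * (x * (1 - x)) * (a - 1) - 2 * K * g

lemma tripleMoments_tripleT {d : ℕ} {x : ℝ} (hx0 : 0 ≤ x) (hx1 : x < 1) (b : ℤˣ) (u w : Fin d → ℝ) :
    ∃ K, 0 ≤ K ∧ 2 * K ≤ 1 - x ^ 2 ∧
      TripleMoments d x (signVal b) (w ⬝ᵥ w) (w ⬝ᵥ u) (u ⬝ᵥ u) K (tripleT x b u w) := by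
  set ρ := rho x with hρ
  set σ := √(1 - ρ ^ 2) with hσ
  set κ := √(1 - x ^ 2) with hκ
  have hρ0 : 0 ≤ ρ := rho_nonneg x
  have hσ0 : 0 ≤ σ := Real.sqrt_nonneg _
  have hR : (1 + x) * ρ ^ 2 = x := by rw [hρ, rho_sq hx0 hx1]; field_simp
  have hσ2 : σ ^ 2 = 1 - ρ ^ 2 := Real.sq_sqrt (by linarith [rho_sq_le hx0 hx1])
  have hx2 : 0 ≤ 1 - x ^ 2 := by nlinarith
  have hκ2 : κ ^ 2 = 1 - x ^ 2 := Real.sq_sqrt hx2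
  have hκ0 : 0 ≤ κ := Real.sqrt_nonneg _
  have hs : signVal b * signVal b = 1 := by rw [← pow_two, signVal_sq]
  have hs2 : √(1 - (signVal b * x) ^ 2) = κ := by rw [mul_pow, signVal_sq, one_mul]
  have hr2 : κ ^ 2 * ρ ^ 2 = x * (1 - x) := by rw [hκ2]; linear_combination (1 - x) * hR
  have hq2 : κ ^ 2 * σ ^ 2 = 1 - x := by rw [hσ2, mul_sub, hr2, hκ2]; ring
  have hs3 : √(1 - (-signVal b * (2 * x - 1)) ^ 2) = 2 * (κ * ρ) := by
    rw [mul_pow, neg_sq, signVal_sq, one_mul, ← Real.sqrt_sq (show 0 ≤ 2 * (κ * ρ) by positivity)]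
    congr 1
    linear_combination -4 * hr2
  refine ⟨κ ^ 2 * (ρ * σ), by positivity, ?_, ?_⟩
  · have : 2 * (ρ * σ) ≤ 1 := by nlinarith [sq_nonneg (ρ - σ)]
    rw [hκ2]; nlinarith
  · constructor <;> simp only [tripleT_zero, tripleT_one, tripleT_two hx0, inner_e₀_pointA,
      inner_pointA, signVal_neg, hs2, hs3, add_dotProduct, dotProduct_add, smul_dotProduct,
      dotProduct_smul, neg_dotProduct, dotProduct_neg, smul_eq_mul, dotProduct_comm u w, ← hρ, ← hσ]
    · linear_combination x ^ 2 * hs + (w ⬝ᵥ w) * hr2 + (u ⬝ᵥ u) * hq2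
    · linear_combination x ^ 2 * hs + (w ⬝ᵥ w) * hr2 + (u ⬝ᵥ u) * hq2
    · linear_combination (2 * x - 1) ^ 2 * hs + 4 * (w ⬝ᵥ w) * hr2
    · linear_combination x ^ 2 * hs + (w ⬝ᵥ w) * hr2 - (u ⬝ᵥ u) * hq2
    · linear_combination -x * (2 * x - 1) * hs - 2 * (w ⬝ᵥ w) * hr2
    · linear_combination -x * (2 * x - 1) * hs - 2 * (w ⬝ᵥ w) * hr2

/-! ### Rounding errors -/

/-- The unit vector in the direction of `c`. -/
noncomputable def unitize {d : ℕ} (c : Space d) : Space d := if c = 0 then e₀ d else ‖c‖⁻¹ • c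

lemma norm_unitize {d : ℕ} (c : Space d) : ‖unitize c‖ = 1 := by
  unfold unitize
  split_ifs with h
  · exact norm_e₀ d
  · rw [norm_smul, norm_inv, norm_norm, inv_mul_cancel₀ (norm_ne_zero_iff.2 h)]

lemma norm_sub_unitize {d : ℕ} (c : Space d) : ‖c - unitize c‖ = |‖c‖ - 1| := by
  unfold unitize
  split_ifs with h
  · simp [h, norm_e₀]
  · have hc := norm_ne_zero_iff.2 h
    have : c - ‖c‖⁻¹ • c = (1 - ‖c‖⁻¹) • c := by module
    rw [this, norm_smul, Real.norm_eq_abs, ← abs_of_nonneg (norm_nonneg c), ← abs_mul,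
      abs_of_nonneg (norm_nonneg c), sub_mul, inv_mul_cancel₀ hc, one_mul]

lemma abs_norm_sub_one_le {d : ℕ} {p : Space d} {t : ℝ} (h : |inner ℝ p p - 1| ≤ t) :
    |‖p‖ - 1| ≤ t := by
  rw [real_inner_self_eq_norm_sq, show ‖p‖ ^ 2 - 1 = (‖p‖ - 1) * (‖p‖ + 1) by ring, abs_mul] at h
  have h2 : 1 ≤ |‖p‖ + 1| := by rw [abs_of_nonneg (by positivity)]; linarith [norm_nonneg p]
  nlinarith [abs_nonneg (‖p‖ - 1)]

lemma norm_sub_unitize_le {d : ℕ} {p c : Space d} {t : ℝ} (h : |inner ℝ p p - 1| ≤ 2 * t)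
    (hc : dist p c ≤ t) : ‖p - unitize c‖ ≤ 4 * t := by
  have h1 := abs_norm_sub_one_le h
  rw [dist_eq_norm] at hc
  have h2 := (norm_sub_le_norm_sub_add_norm_sub p c (unitize c))
  rw [norm_sub_unitize] at h2
  have h3 := abs_norm_sub_norm_le p c
  have h4 : |‖c‖ - 1| ≤ |‖p‖ - ‖c‖| + |‖p‖ - 1| := by
    rw [abs_sub_comm ‖p‖ ‖c‖]; exact abs_sub_le _ _ _
  linarith

lemma abs_inner_sub_inner_le {d : ℕ} {p p' c c' : Space d} {t : ℝ} (ht0 : 0 ≤ t) (ht : t ≤ 1 / 8)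
    (hp : |inner ℝ p p - 1| ≤ 2 * t) (h : ‖p - c‖ ≤ 4 * t) (h' : ‖p' - c'‖ ≤ 4 * t)
    (hc' : ‖c'‖ = 1) : |inner ℝ p p' - inner ℝ c c'| ≤ 9 * t := by
  have h1 := abs_le.1 (abs_norm_sub_one_le hp)
  have e : inner ℝ p p' - inner ℝ c c' = inner ℝ p (p' - c') + inner ℝ (p - c) c' := by
    rw [inner_sub_left, inner_sub_right]; ring
  rw [e]
  have h2 : |inner ℝ p (p' - c')| ≤ (1 + 2 * t) * (4 * t) :=
    (abs_real_inner_le_norm _ _).trans (mul_le_mul (by linarith) h' (norm_nonneg _) (by linarith))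
  have h3 : |inner ℝ (p - c) c'| ≤ 4 * t := by
    have := abs_real_inner_le_norm (p - c) c'
    rw [hc', mul_one] at this
    exact this.trans h
  have h4 := abs_add_le (inner ℝ p (p' - c')) (inner ℝ (p - c) c')
  nlinarith

lemma abs_inner_e₀_sub_le {d : ℕ} {p c : Space d} {t : ℝ} (h : ‖p - c‖ ≤ t) :
    |inner ℝ (e₀ d) p - inner ℝ (e₀ d) c| ≤ t := by
  rw [← inner_sub_right]
  have := abs_real_inner_le_norm (e₀ d) (p - c)
  rw [norm_e₀, one_mul] at this
  exact this.trans h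

/-! ### Completeness -/

lemma half_pow_k₀_le {ε : ℝ} (hε₀ : 0 < ε) : (1 / 2 : ℝ) ^ k₀ ε ≤ ε := by
  have h1 : 1 / ε ≤ (2 : ℝ) ^ ⌈Real.logb 2 (1 / ε)⌉₊ := by
    rw [← Real.rpow_natCast, ← Real.logb_le_iff_le_rpow (by norm_num) (by positivity)]
    exact Nat.le_ceil _
  have h2 : (2 : ℝ) ^ ⌈Real.logb 2 (1 / ε)⌉₊ ≤ 2 ^ k₀ ε :=
    pow_le_pow_right₀ (by norm_num) (by unfold k₀; omega)
  rw [one_div, inv_pow, inv_le_comm₀ (by positivity) hε₀, ← one_div]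
  exact h1.trans h2

lemma half_le_level_succ (j : ℕ) : 1 / 2 ≤ level (j + 1) := by
  have := level_nonneg j
  have := level_succ j
  linarith

lemma norm_le_two_of_inner_self {d : ℕ} {p : Space d} {t : ℝ} (ht : t ≤ 1 / 2)
    (h : |inner ℝ p p - 1| ≤ 2 * t) : ‖p‖ ≤ 2 := by
  have := (abs_le.1 (abs_norm_sub_one_le h)).2
  linarith

/-- If `u` and `w` are almost orthonormal, the inner products of a triple are almost ideal. -/
lemma TripleMoments.bounds {d : ℕ} {x s a g h K t : ℝ} {p : Fin 3 → Space d}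
    (H : TripleMoments d x s a g h K p) (hx0 : 0 ≤ x) (hx1 : x < 1) (hK0 : 0 ≤ K)
    (hK : 2 * K ≤ 1 - x ^ 2) (ha : |a - 1| ≤ t) (hh : |h - 1| ≤ t) (hg : |g| ≤ t) :
    (∀ i, |inner ℝ (p i) (p i) - 1| ≤ 2 * t) ∧ |inner ℝ (p 0) (p 1) - (2 * x - 1)| ≤ 2 * t ∧
      |inner ℝ (p 0) (p 2) + x| ≤ 2 * t ∧ |inner ℝ (p 1) (p 2) + x| ≤ 2 * t := by
  have ht : 0 ≤ t := (abs_nonneg _).trans ha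
  have hxx : 0 ≤ x * (1 - x) := by nlinarith
  have hxx4 : 4 * (x * (1 - x)) ≤ 1 := by nlinarith [sq_nonneg (2 * x - 1)]
  have b1 : |x * (1 - x) * (a - 1)| ≤ x * (1 - x) * t := by
    rw [abs_mul, abs_of_nonneg hxx]; gcongr
  have b2 : |(1 - x) * (h - 1)| ≤ (1 - x) * t := by
    rw [abs_mul, abs_of_pos (sub_pos.2 hx1)]; have := sub_pos.2 hx1; gcongr
  have b3 : |K * g| ≤ K * t := by
    rw [abs_mul, abs_of_nonneg hK0]; gcongr
  obtain ⟨l1, u1⟩ := abs_le.1 b1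
  obtain ⟨l2, u2⟩ := abs_le.1 b2
  obtain ⟨l3, u3⟩ := abs_le.1 b3
  have c1 : 4 * (x * (1 - x) * t) ≤ t := by nlinarith
  -- The last two coefficients add up to `1 - x²`, which also bounds `2K`.
  have c2 : 2 * (K * t) + x * (1 - x) * t + (1 - x) * t ≤ 2 * t := by nlinarith
  have c3 : 2 * (K * t) ≤ t := by nlinarith
  have c4 : x * (1 - x) * t + (1 - x) * t ≤ t := by nlinarith
  refine ⟨fun i => ?_, ?_, ?_, ?_⟩
  · fin_cases i
    · simp only [Fin.zero_eta, H.p00]; rw [abs_le]; constructor <;> linarith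
    · simp only [Fin.mk_one, H.p11]; rw [abs_le]; constructor <;> linarith
    · simp only [Fin.reduceFinMk, H.p22]; rw [abs_le]; constructor <;> linarith
  · rw [H.p01, abs_le]; constructor <;> linarith
  · rw [H.p02, abs_le]; constructor <;> linarith
  · rw [H.p12, abs_le]; constructor <;> linarith

lemma abs_scaled_sub_le {c A B δ : ℝ} (hc0 : 0 ≤ c) (hc1 : c ≤ 1) (h : |A - B| ≤ δ) :
    |c * A - c * B| ≤ δ := by
  rw [← mul_sub, abs_mul, abs_of_nonneg hc0]
  exact (mul_le_of_le_one_left (abs_nonneg _) hc1).trans h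

namespace Discretization

variable {ε : ℝ} {d : ℕ} (D : Discretization ε d)

lemma isApproxVectorAssignment_some (hε₀ : 0 < ε) (hε₁ : ε < 1) {N : ℕ}
    {v₀ : EuclideanSpace ℝ (Fin N)} {v : D.Var → EuclideanSpace ℝ (Fin N)} (hv : ∀ c, ‖v c‖ = 1)
    (hv₀ : ∀ c, inner ℝ v₀ (v c) = (1 - ε / 10) * inner ℝ (e₀ d) (unitize c.1))
    (hvv : ∀ c c', c ≠ c' →
      inner ℝ (v c) (v c') = (1 - ε / 10) * inner ℝ (unitize c.1) (unitize c'.1))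
    (j : Fin (k₀ ε)) (b : ℤˣ) {u w : Fin d → ℝ} (hnd : ¬ Discarded ε (some j, b) u w) :
    IsApproxVectorAssignment oneInThree ε v₀ fun i => (D.clause (some j, b) u w i).vec v₀ v := by
  obtain ⟨t, rfl⟩ : ∃ t, ε = 1000 * t := ⟨ε / 1000, by ring⟩
  simp only [Discarded, ne_eq, reduceCtorEq, not_false_eq_true, true_and, not_or, not_lt,
    mul_div_cancel_left₀ t (by norm_num : (1000 : ℝ) ≠ 0)] at hnd
  obtain ⟨hw, hu, hwu⟩ := hnd
  have ht0 : 0 < t := by linarith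
  set x := level (j + 1)
  have hx0 : 0 ≤ x := level_nonneg _
  have hx1 : x < 1 := level_lt_one _
  have hxh : 1 / 2 ≤ x := half_le_level_succ _
  obtain ⟨K, hK0, hK, H⟩ := tripleMoments_tripleT hx0 hx1 b u w
  obtain ⟨hself, h01, h02, h12⟩ := H.bounds hx0 hx1 hK0 hK hw hu hwu
  set p := tripleT x b u w with hp
  set s := signVal b
  have hss : s * s = 1 := by rw [← pow_two, signVal_sq]
  set c : Fin 3 → D.Var := fun i => D.round (p i) with hc
  have hdist : ∀ i, dist (p i) (c i).1 ≤ t := fun i => by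
    have := D.dist_center_le (p i) (norm_le_two_of_inner_self (by linarith) (hself i))
    rwa [mul_div_cancel_left₀ t (by norm_num : (1000 : ℝ) ≠ 0)] at this
  have hnear : ∀ i, ‖p i - unitize (c i).1‖ ≤ 4 * t := fun i => norm_sub_unitize_le (hself i) (hdist i)
  have hvec : (fun i => (D.clause (some j, b) u w i).vec v₀ v) = fun i => (-s) • v (c i) := by
    funext i
    simp only [clause, Literal.vec, signVal_neg]; rfl
  rw [hvec]
  have hη0 : 0 ≤ 1 - 1000 * t / 10 := by linarith
  have hη1 : 1 - 1000 * t / 10 ≤ 1 := by linarith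
  set η := 1000 * t / 10 with hη
  have hnorm : ∀ i, ‖(-s) • v (c i)‖ = 1 := fun i => by
    rw [norm_smul, hv, mul_one, Real.norm_eq_abs, ← sq_eq_sq₀ (abs_nonneg _) zero_le_one, sq_abs]
    linarith
  have hfirst : ∀ i, inner ℝ v₀ ((-s) • v (c i))
      = (1 - η) * (-s * inner ℝ (e₀ d) (unitize (c i).1)) := fun i => by
    rw [real_inner_smul_right, hv₀]; ring
  have hsecond : ∀ i i', c i ≠ c i' → inner ℝ ((-s) • v (c i)) ((-s) • v (c i'))
      = (1 - η) * inner ℝ (unitize (c i).1) (unitize (c i').1) := fun i i' h => by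
    rw [real_inner_smul_left, real_inner_smul_right, hvv _ _ h]
    linear_combination (1 - η) * inner ℝ (unitize (c i).1) (unitize (c i').1) * hss
  have hE : ∀ i m, inner ℝ (e₀ d) (p i) = -s * m →
      |-s * inner ℝ (e₀ d) (unitize (c i).1) - m| ≤ 4 * t := fun i m hm => by
    have h1 := abs_inner_e₀_sub_le (hnear i)
    have e : -s * inner ℝ (e₀ d) (unitize (c i).1) - m
        = s * (inner ℝ (e₀ d) (p i) - inner ℝ (e₀ d) (unitize (c i).1)) := by
      rw [hm]; linear_combination m * hss
    have hs1 : |s| = 1 := by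
      rw [← sq_eq_sq₀ (abs_nonneg _) zero_le_one, sq_abs]; linarith
    rw [e, abs_mul, hs1, one_mul]; exact h1
  -- The error `11 t` is `9 t` from rounding and normalizing plus `2 t` from non-orthonormality; `6
  -- * 11 t ≤ 100 t = η`.
  have hP : ∀ i i' m, |inner ℝ (p i) (p i') - m| ≤ 2 * t →
      |inner ℝ (unitize (c i).1) (unitize (c i').1) - m| ≤ 11 * t := fun i i' m hm => by
    have h1 := abs_inner_sub_inner_le ht0.le (by linarith) (hself i) (hnear i) (hnear i')
      (norm_unitize _)
    have h1 := abs_le.1 h1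
    have h2 := abs_le.1 hm
    rw [abs_le]; constructor <;> linarith
  have f0 := abs_scaled_sub_le hη0 hη1 (hE 0 (-x) (by rw [H.e0]; ring))
  have f1 := abs_scaled_sub_le hη0 hη1 (hE 1 (-x) (by rw [H.e1]; ring))
  have f2 := abs_scaled_sub_le hη0 hη1 (hE 2 (2 * x - 1) (by rw [H.e2]))
  have f02 := abs_scaled_sub_le hη0 hη1 (hP 0 2 (-x) (by rwa [sub_neg_eq_add]))
  have f12 := abs_scaled_sub_le hη0 hη1 (hP 1 2 (-x) (by rwa [sub_neg_eq_add]))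
  have f01 := abs_scaled_sub_le hη0 hη1 (hP 0 1 (2 * x - 1) h01)
  -- A common center would put the points within `2 t`, but their `e₀`-coordinates differ by `3x - 1
  -- ≥ 1/2`.
  have hfar : ∀ i, inner ℝ (e₀ d) (p i) = s * x → c i ≠ c 2 := fun i hi heq => by
    have h1 := abs_inner_e₀_sub_le (show ‖p i - p 2‖ ≤ 2 * t by
      rw [← dist_eq_norm]
      have h2 := hdist 2
      have h3 := dist_triangle_right (p i) (p 2) (c i).1
      rw [← heq] at h2
      linarith [hdist i])
    rw [hi, H.e2, show s * x - -s * (2 * x - 1) = s * (3 * x - 1) by ring, abs_mul,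
      abs_of_nonneg (by linarith : (0 : ℝ) ≤ 3 * x - 1)] at h1
    have hs1 : |s| = 1 := by
      rw [← sq_eq_sq₀ (abs_nonneg _) zero_le_one, sq_abs]; linarith
    rw [hs1] at h1
    linarith
  have hne02 := hfar 0 H.e0
  have hne12 := hfar 1 H.e1
  rw [← hfirst, mul_neg, sub_neg_eq_add] at f0 f1
  rw [← hfirst] at f2
  rw [← hsecond _ _ hne02, mul_neg, sub_neg_eq_add] at f02
  rw [← hsecond _ _ hne12, mul_neg, sub_neg_eq_add] at f12
  -- A common center makes `p 0 - p 1` short; its squared length is `4 (1 - x) ‖u‖²`, so `x` is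
  -- within `t` of 1 and the distribution with `a 0 = a 1` is good enough.
  by_cases h : c 0 = c 1
  · have hpp : ‖p 0 - p 1‖ ≤ 2 * t := by
      rw [← dist_eq_norm]
      have h2 := hdist 1
      have h3 := dist_triangle_right (p 0) (p 1) (c 0).1
      rw [← h] at h2
      linarith [hdist 0]
    have hsq : inner ℝ (p 0 - p 1) (p 0 - p 1) = 4 * (1 - x) * (u ⬝ᵥ u) := by
      rw [inner_sub_left, inner_sub_right, inner_sub_right, real_inner_comm (p 0) (p 1), H.p00, H.p11,
        H.p01]
      ring
    rw [real_inner_self_eq_norm_sq] at hsq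
    have hle : ‖p 0 - p 1‖ ^ 2 ≤ (2 * t) ^ 2 := by gcongr
    have hx : 1 - x ≤ t := by
      have := (abs_le.1 hu).1
      have h5 : (1 - x) * (1 / 2) ≤ (1 - x) * (u ⬝ᵥ u) := by gcongr <;> linarith
      nlinarith
    have hX0 : (1 - η) * (1 - x) ≤ t := (mul_le_of_le_one_left (by linarith) hη1).trans hx
    have hX1 : 0 ≤ (1 - η) * (1 - x) := mul_nonneg hη0 (by linarith)
    obtain ⟨f0, f0'⟩ := abs_le.1 f0
    obtain ⟨f2, f2'⟩ := abs_le.1 f2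
    obtain ⟨f02, f02'⟩ := abs_le.1 f02
    apply isApproxVectorAssignment_of_eq hnorm (by simp only [h]) <;> linarith
  · rw [← hsecond _ _ h] at f01
    exact isApproxVectorAssignment_of_near hnorm (η := η) (δ := 11 * t) hx0 hx1.le (by linarith)
      (by linarith) (by linarith) (f0.trans (by linarith)) (f1.trans (by linarith))
      (f2.trans (by linarith)) f01 f02 f12

lemma isApproxVectorAssignment_none (hε₀ : 0 < ε) (hε₁ : ε < 1) {N : ℕ}
    {v₀ : EuclideanSpace ℝ (Fin N)} {v : D.Var → EuclideanSpace ℝ (Fin N)} (hn₀ : ‖v₀‖ = 1)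
    (hv : ∀ c, ‖v c‖ = 1)
    (hv₀ : ∀ c, inner ℝ v₀ (v c) = (1 - ε / 10) * inner ℝ (e₀ d) (unitize c.1))
    (b : ℤˣ) {u w : Fin d → ℝ} (hnd : ¬ Discarded ε (none, b) u w) :
    IsApproxVectorAssignment oneInThree ε v₀ fun i => (D.clause (none, b) u w i).vec v₀ v := by
  have hw : |w ⬝ᵥ w - 1| ≤ ε / 1000 := by
    simp only [Discarded, ne_eq, not_true_eq_false, false_and, or_false, not_lt] at hnd
    exact hnd
  set s := signVal b
  have hss : s * s = 1 := by rw [← pow_two, signVal_sq]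
  have hs1 : |s| = 1 := by
    rw [← sq_eq_sq₀ (abs_nonneg _) zero_le_one, sq_abs]; linarith
  set x := level (k₀ ε) with hx
  have hx0 : 0 ≤ x := level_nonneg _
  have hx1 : x < 1 := level_lt_one _
  have hxε : 1 - x ≤ ε := by rw [hx, level]; linarith [half_pow_k₀_le hε₀]
  set p := pointA (s * x) w with hp
  have hy : (s * x) ^ 2 = x ^ 2 := by rw [mul_pow, signVal_sq, one_mul]
  have hx2 : 0 ≤ 1 - x ^ 2 := by nlinarith
  have hself : |inner ℝ p p - 1| ≤ 2 * (ε / 1000) := by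
    have e : inner ℝ p p - 1 = (1 - x ^ 2) * (w ⬝ᵥ w - 1) := by
      rw [hp, inner_pointA, hy, Real.mul_self_sqrt hx2]
      linear_combination x ^ 2 * hss
    rw [e, abs_mul, abs_of_nonneg hx2]
    have := abs_nonneg (w ⬝ᵥ w - 1)
    nlinarith
  set c := D.round p
  have hdist : dist p c.1 ≤ ε / 1000 :=
    D.dist_center_le p (norm_le_two_of_inner_self (by linarith) hself)
  have h1 := abs_inner_e₀_sub_le (norm_sub_unitize_le hself hdist)
  rw [hp, inner_e₀_pointA] at h1
  have hvec : (fun i => (D.clause (none, b) u w i).vec v₀ v) = ![-v₀, -v₀, s • v c] := by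
    funext i
    fin_cases i <;> simp [clause, Literal.vec] <;> rfl
  rw [hvec]
  have hM : inner ℝ v₀ (s • v c) = (1 - ε / 10) * (s * inner ℝ (e₀ d) (unitize c.1)) := by
    rw [real_inner_smul_right, hv₀]; ring
  have hns : ‖s • v c‖ = 1 := by rw [norm_smul, hv, Real.norm_eq_abs, hs1, one_mul]
  have hM1 := abs_real_inner_le_norm v₀ (s • v c)
  rw [hn₀, hns, one_mul] at hM1
  have hm : |x - s * inner ℝ (e₀ d) (unitize c.1)| ≤ 4 * (ε / 1000) := by
    have e : x - s * inner ℝ (e₀ d) (unitize c.1) = s * (s * x - inner ℝ (e₀ d) (unitize c.1)) := by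
      linear_combination -x * hss
    rw [e, abs_mul, hs1, one_mul]; exact h1
  -- The first two entries are fixed to `-1`, so the satisfying mass is half of 1 plus this inner
  -- product. The choice of `k₀` enters through `1 - x ≤ ε`.
  have hlow : 1 - 2 * ε ≤ inner ℝ v₀ (s • v c) := by
    rw [hM]
    have := (abs_le.1 hm).2
    nlinarith
  obtain ⟨hM2, hM3⟩ := abs_le.1 hM1
  have h00 : inner ℝ v₀ (-v₀) = (-1 : ℝ) := by
    rw [inner_neg_right, real_inner_self_eq_norm_sq, hn₀]; norm_num
  refine isApproxVectorAssignment_of_eq (fun i => ?_) rfl ?_ ?_ ?_ ?_ ?_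
  · fin_cases i <;> simp [hn₀, hns]
  all_goals
    simp only [Matrix.cons_val, h00, inner_neg_left]
    linarith

theorem exists_vectors (hε₀ : 0 < ε) (hε₁ : ε < 1) :
    ∃ (N : ℕ) (v₀ : EuclideanSpace ℝ (Fin N)) (v : D.Var → EuclideanSpace ℝ (Fin N)),
      ‖v₀‖ = 1 ∧ (∀ x, ‖v x‖ = 1) ∧
      ∀ C : Clause D.Var, D.Retained C →
        IsApproxVectorAssignment oneInThree ε v₀ (fun i => (C i).vec v₀ v) := by
  obtain ⟨N, v₀, v, hn₀, hn, hv₀, hv⟩ := exists_noisy_vectors (norm_e₀ d)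
    (h := fun c : D.Var => unitize c.1) (fun c => norm_unitize _)
    (η := ε / 10) (by positivity) (by linarith)
  refine ⟨N, v₀, v, hn₀, hn, ?_⟩
  rintro C ⟨⟨_ | j, b⟩, u, w, hnd, rfl⟩
  · exact D.isApproxVectorAssignment_none hε₀ hε₁ hn₀ hn hv₀ b hnd
  · exact D.isApproxVectorAssignment_some hε₀ hε₁ hn hv₀ hv j b hnd

end Discretization

end OneInThreeGap

theorem mainTheorem8 (ε : ℝ) (hε₀ : 0 < ε) (hε₁ : ε < 1) (d : ℕ)
    (hd : 80000000 / ε ^ 3 ≤ (d : ℝ)) :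
    Nonempty (OneInThreeGap.Discretization ε d) ∧
    ∀ D : OneInThreeGap.Discretization ε d,
      (∃ (N : ℕ) (v₀ : EuclideanSpace ℝ (Fin N)) (v : D.Var → EuclideanSpace ℝ (Fin N)),
        ‖v₀‖ = 1 ∧ (∀ x, ‖v x‖ = 1) ∧
        ∀ C : OneInThreeGap.Clause D.Var, D.Retained C →
          OneInThreeGap.IsApproxVectorAssignment OneInThreeGap.oneInThree ε v₀
            (fun i => (C i).vec v₀ v)) ∧
      OneInThreeGap.sampleProb ε d (OneInThreeGap.Discarded ε) ≤ 6 * Real.exp (-10 / ε) ∧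
      ∀ f : D.Var → ℤˣ,
        1 / (10 ^ 60 * (⌈Real.logb 2 (1 / ε)⌉₊ : ℝ)) ≤ D.violatedWeight f := by
  exact ⟨OneInThreeGap.nonempty_discretization hε₀ d, fun D => ⟨D.exists_vectors hε₀ hε₁,
    OneInThreeGap.sampleProb_discarded_le hε₀ hε₁ hd, D.le_violatedWeight hε₀ hε₁⟩⟩
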